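/- **Setting.** Fix a probability distribution $\mathcal D$ on $\mathbb R$ supported on $[-b,b]$ with mean $0$ and variance $1$, and fix $\sigma>0$. Consider a sequence of problems in which the dimensions $n$, $p$, $r$ all tend to infinity; all other quantities below, except $\mathcal D,b,\sigma$, may vary along the sequence. Let $\boldsymbol X\in\mathbb R^{n\times p}$ have i.i.d. entries from $\mathcal D$; let $\xi\in\mathbb R^n$ have i.i.d. entries distributed as $\mathcal N(0,\sigma^2)$ conditioned on having absolute value at most $b_n$, where $b_n>0$, $b_n=O(\sigma\sqrt{\log n})$ and $b_n/\sigma-\sqrt{2\log(2n)}\to\infty$; let $\theta_0\in\mathbb R^p$ be deterministic with $\|\theta_0\|_2=1$ and $s_0=|\{j:\theta_{0,j}\ne0\}|$; and let $y=\boldsymbol X\theta_0+\xi$. Let $\boldsymbol R=[\boldsymbol R_1\ \boldsymbol R_2\ \boldsymbol R_3]\in\mathbb R^{r\times(n+p+1)}$ (blocks with $n$, $p$ and $1$ columns) have i.i.d. $\mathcal N(0,1/r)$ entries, with $\boldsymbol X,\xi,\boldsymbol R$ independent. Let $B>0$ be such that almost surely every row of $[\boldsymbol X\ y]$ has $\ell_2$-norm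 at most $B$, let $\epsilon>0$ and $\delta\in(0,1/e)$, and let $w>0$ be given by $$w^2=\frac{4B^2}{\epsilon}\Big(\sqrt{2r\log(4/\delta)}+\log(4/\delta)\Big).$$ Put $[\boldsymbol X^*\ y^*]=\boldsymbol R\begin{bmatrix}\boldsymbol X\ \ y\\ w\boldsymbol I_{p+1}\end{bmatrix}$, that is, $\boldsymbol X^*=\boldsymbol R_1\boldsymbol X+w\boldsymbol R_2$ and $y^*=\boldsymbol R_1y+w\boldsymbol R_3$. For $\lambda>0$ let $\widehat\theta^*$ be any minimizer over $\theta\in\mathbb R^p$ of $\frac1{2n}\|\boldsymbol X^*\theta-y^*\|_2^2+\lambda\|\theta\|_1$. The debiased estimator $\widehat\theta^u=\widehat\theta^*+\frac1n\boldsymbol X^{*\top}(y^*-\boldsymbol X^*\widehat\theta^*)+\frac{w^2}{n}\widehat\theta^*$ decomposes as $\widehat\theta^u=\theta_0+\frac1n\boldsymbol X^{*\top}\boldsymbol R_1\xi+\Delta$ with bias term $$\Delta=\Big(\tfrac1n\boldsymbol X^\top\boldsymbol X-\boldsymbol I_p\Big)(\theta_0-\widehat\theta^*)+\tfrac1n[\boldsymbol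 X^\top\ w\boldsymbol I_p\ \mathbf 0](\boldsymbol R^\top\boldsymbol R-\boldsymbol I_{n+p+1})\begin{bmatrix}\boldsymbol X(\theta_0-\widehat\theta^*)\\-w\widehat\theta^*\\ w\end{bmatrix}.$$ **Theorem.** There exists an absolute constant $C_\lambda>0$ such that, in the above setting with $$\lambda=C_\lambda\,\sigma\max\Big\{\sqrt{\tfrac{\log p}{n}},\sqrt{\tfrac{(\log p)^3}{r}}\Big\},\quad \rho_n^2=\frac{n+r+1}{nr}+\frac{w^2}{nr},\quad \phi_w=1+\frac{w^2}{n},\quad \kappa_n=2\lambda\sqrt{s_0}+\frac{w^2}{n},$$ if all of the following conditions hold, 1. $\dfrac{\kappa_n^2}{\lambda^2\phi_w}=o\Big(\sqrt{\frac{n}{\log p}}\cdot\min\Big\{1,\sqrt{\frac rn},\frac{\sqrt{rn}}{w^2}\Big\}\Big)$, 2. $\sqrt{s_0}=O\left(\dfrac{\max\{\frac1{\sqrt n},\frac{\log p}{\sqrt r}\}}{\max\{\frac{w\log p}{\sqrt{nr}},\frac{w^2}{n}\sqrt{\frac{\log p}{r}}\}}\right)$, 3. $\dfrac{1}{\sigma\rho_n}\sqrt{s_0}=o\Big(\min\Big\{\frac{n}{w^2}\sqrt{\frac{r}{\log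 p}},\frac{\sqrt{nr}}{w\log p}\Big\}\Big)$, 4. $\dfrac{1}{\sigma\rho_n}\dfrac{4\kappa_n^2}{\lambda\phi_w}=o\Big(\min\Big\{\sqrt{\frac n{\log p}},\sqrt{\frac r{\log p}},\frac n{w^2}\sqrt{\frac r{\log p}},\frac{\sqrt{nr}}{w\log p}\Big\}\Big)$, then $\|\Delta\|_\infty=o_p(\sigma\rho_n)$, i.e. $\mathbb P\big(\|\Delta\|_\infty/(\sigma\rho_n)>\eta\big)\to0$ for every $\eta>0$. -/

import Mathlib

open MeasureTheory ProbabilityTheory Filter Asymptotics Topology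
open scoped Matrix NNReal ENNReal

namespace PrivateLasso

/-- The law `𝒟` of the design entries: a probability measure supported on `[-b, b]`,
with mean zero and variance one. -/
structure IsDesignLaw (𝒟 : Measure ℝ) (b : ℝ) : Prop where
  isProbabilityMeasure : IsProbabilityMeasure 𝒟
  support : 𝒟 (Set.Icc (-b) b)ᶜ = 0
  mean : ∫ x, x ∂𝒟 = 0
  variance : Var[fun x => x; 𝒟] = 1

/-- The truncated Gaussian `𝒯𝒩(0, σ², τ)`: the law of `g ∼ 𝒩(0, σ²)` conditioned on `|g| ≤ τ`. -/
noncomputable def truncGaussian (σ τ : ℝ) : Measure ℝ :=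
  (gaussianReal 0 (σ ^ 2).toNNReal)[|Set.Icc (-τ) τ]

/-- The `n + p + 1` columns of the projection matrix `R = [R₁ R₂ R₃]`. -/
abbrev Cols (n p : ℕ) : Type := Fin n ⊕ (Fin p ⊕ Fin 1)

/-- All the scalar random variables of the model: the entries of `X`, `ξ` and `R`. -/
def entries {Ω : Type*} {n p r : ℕ} (X : Ω → Matrix (Fin n) (Fin p) ℝ) (ξ : Ω → Fin n → ℝ)
    (R : Ω → Matrix (Fin r) (Cols n p) ℝ) :
    (Fin n × Fin p) ⊕ (Fin n ⊕ (Fin r × Cols n p)) → Ω → ℝ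
  | .inl ij, ω => X ω ij.1 ij.2
  | .inr (.inl i), ω => ξ ω i
  | .inr (.inr ai), ω => R ω ai.1 ai.2

/-- The randomness of the model: the entries of `X` are drawn from `𝒟`, those of `ξ` from the
truncated Gaussian, those of `R` from `𝒩(0, 1/r)`, all of them mutually independent. -/
structure IsSample {Ω : Type*} [MeasurableSpace Ω] (P : Measure Ω) {n p r : ℕ}
    (𝒟 : Measure ℝ) (σ τ : ℝ) (X : Ω → Matrix (Fin n) (Fin p) ℝ) (ξ : Ω → Fin n → ℝ)
    (R : Ω → Matrix (Fin r) (Cols n p) ℝ) : Prop where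
  law_design : ∀ i j, HasLaw (fun ω => X ω i j) 𝒟 P
  law_noise : ∀ i, HasLaw (fun ω => ξ ω i) (truncGaussian σ τ) P
  law_proj : ∀ a c, HasLaw (fun ω => R ω a c) (gaussianReal 0 (r : ℝ≥0)⁻¹) P
  indep : iIndepFun (entries X ξ R) P

/-- The linear model `y = X θ₀ + ξ`. -/
def response {n p : ℕ} (X : Matrix (Fin n) (Fin p) ℝ) (θ₀ : Fin p → ℝ) (ξ : Fin n → ℝ) :
    Fin n → ℝ :=
  X *ᵥ θ₀ + ξ

/-- The sparsity level `s₀ = #{j : θ₀ⱼ ≠ 0}`. -/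
noncomputable def sparsity {p : ℕ} (θ₀ : Fin p → ℝ) : ℕ := {j | θ₀ j ≠ 0}.ncard

/-- `B` bounds the Euclidean norm of every row of `[X y]`. -/
def RowBound {n p : ℕ} (X : Matrix (Fin n) (Fin p) ℝ) (y : Fin n → ℝ) (B : ℝ) : Prop :=
  ∀ i, √(∑ j, X i j ^ 2 + y i ^ 2) ≤ B

/-- The privacy parameter `w > 0` with
`w² = (4 B² / ε) (√(2 r log (4/δ)) + log (4/δ))`. -/
noncomputable def privacyW (B ε δ : ℝ) (r : ℕ) : ℝ :=
  √(4 * B ^ 2 / ε * (√(2 * r * Real.log (4 / δ)) + Real.log (4 / δ)))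

/-- The released matrix `[X* y*] = R · [[X y]; w I]`. -/
def release {n p r : ℕ} (R : Matrix (Fin r) (Cols n p) ℝ) (X : Matrix (Fin n) (Fin p) ℝ)
    (y : Fin n → ℝ) (w : ℝ) : Matrix (Fin r) (Fin p ⊕ Fin 1) ℝ :=
  R * Matrix.fromRows (Matrix.fromCols X (Matrix.replicateCol (Fin 1) y))
    (w • (1 : Matrix (Fin p ⊕ Fin 1) (Fin p ⊕ Fin 1) ℝ))

/-- The private design `X*`. -/
def privX {n p r : ℕ} (R : Matrix (Fin r) (Cols n p) ℝ) (X : Matrix (Fin n) (Fin p) ℝ)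
    (y : Fin n → ℝ) (w : ℝ) : Matrix (Fin r) (Fin p) ℝ :=
  (release R X y w).toCols₁

/-- The private response `y*`. -/
def privY {n p r : ℕ} (R : Matrix (Fin r) (Cols n p) ℝ) (X : Matrix (Fin n) (Fin p) ℝ)
    (y : Fin n → ℝ) (w : ℝ) : Fin r → ℝ :=
  fun a => (release R X y w).toCols₂ a 0

/-- The objective `(1/2n) ‖A θ - z‖₂² + lam ‖θ‖₁`; `n` is the original sample size, not the
number `r` of rows of `A`. -/
noncomputable def lassoObj {p r : ℕ} (n : ℕ) (A : Matrix (Fin r) (Fin p) ℝ) (z : Fin r → ℝ)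
    (lam : ℝ) (θ : Fin p → ℝ) : ℝ :=
  1 / (2 * n) * ‖WithLp.toLp 2 (A *ᵥ θ - z)‖ ^ 2 + lam * ‖WithLp.toLp 1 θ‖

/-- `θhat` is a private Lasso estimate: a minimizer of the private Lasso objective. -/
def IsPrivateLasso {n p r : ℕ} (R : Matrix (Fin r) (Cols n p) ℝ) (X : Matrix (Fin n) (Fin p) ℝ)
    (y : Fin n → ℝ) (w lam : ℝ) (θhat : Fin p → ℝ) : Prop :=
  ∀ θ, lassoObj n (privX R X y w) (privY R X y w) lam θhat ≤
    lassoObj n (privX R X y w) (privY R X y w) lam θ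

/-- The bias term
`Δ = (XᵀX/n - I)(θ₀ - θhat) + (1/n) [Xᵀ wI 0] (RᵀR - I) [X(θ₀ - θhat); -w θhat; w]`. -/
noncomputable def bias {n p r : ℕ} (R : Matrix (Fin r) (Cols n p) ℝ)
    (X : Matrix (Fin n) (Fin p) ℝ) (w : ℝ) (θ₀ θhat : Fin p → ℝ) : Fin p → ℝ :=
  ((1 / (n : ℝ)) • (Xᵀ * X) - 1) *ᵥ (θ₀ - θhat) +
    (1 / (n : ℝ)) •
      ((Matrix.fromCols Xᵀ (Matrix.fromCols (w • (1 : Matrix (Fin p) (Fin p) ℝ))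
          (0 : Matrix (Fin p) (Fin 1) ℝ)) * (Rᵀ * R - 1)) *ᵥ
        Sum.elim (X *ᵥ (θ₀ - θhat)) (Sum.elim (-(w • θhat)) (fun _ => w)))

/-- `ρₙ`, with `ρₙ² = (n + r + 1)/(n r) + w²/(n r)`. -/
noncomputable def rho (n r : ℕ) (w : ℝ) : ℝ :=
  √(((n : ℝ) + r + 1) / (n * r) + w ^ 2 / (n * r))

/-- `φ_w = 1 + w²/n`. -/
noncomputable def phi (n : ℕ) (w : ℝ) : ℝ := 1 + w ^ 2 / n

/-- `κₙ = 2 lam √s₀ + w²/n`. -/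
noncomputable def kappa (n s₀ : ℕ) (lam w : ℝ) : ℝ := 2 * lam * √(s₀ : ℝ) + w ^ 2 / n

/-- `max {√(log p / n), √((log p)³ / r)}`, the rate of the regularization parameter. -/
noncomputable def lamRate (n p r : ℕ) : ℝ :=
  max √(Real.log p / n) √(Real.log p ^ 3 / r)

end PrivateLasso

/-! With `Z = [X; w I; 0]` the private design is `X* = R Z`, and `X*ᵀ X* / n - φ I` splits into
`Xᵀ X / n - I` and `Zᵀ (RᵀR - I) Z / n`. The entries of the first matrix are concentrated by a
Chernoff bound; those of the second are `RᵀR - I` tested on pairs of columns independent of `R`,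
where the Gaussian Johnson-Lindenstrauss estimate applies. The same estimate, with one of the
columns replaced by the stacked noise `[ξ; -w θ₀; w]`, bounds the score of the private Lasso at
`θ₀`. The entrywise deviation of the Gram matrix then enters twice: it controls the `ℓ₁`-error of
the Lasso, which is at most `2 κ² / (λ φ)`, and it converts this error into a bound for the bias;
what remains of the bias is the contribution of the shift `[0; -w θ₀; w]`.

For the rates, conditions 2 and 4 keep `w² / n` bounded. Hence the score is at most
`4 σ max {√(log p / n), log p √(log p / r)} ≤ λ / 2`, condition 1 makes the Gram deviation
negligible against the curvature `λ² φ / κ²`, and conditions 3 and 4 make the two parts of the bias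
negligible against `σ ρ`. -/

namespace PrivateLasso

section Independence

variable {Ω : Type*} [MeasurableSpace Ω] {P : Measure Ω}

lemma measureReal_prodMk_mem_le {α β : Type*} [MeasurableSpace α] [MeasurableSpace β]
    [IsProbabilityMeasure P] {U : Ω → α} {V : Ω → β}
    (hU : AEMeasurable U P) (hV : AEMeasurable V P) (hUV : IndepFun U V P)
    {S : Set (α × β)} (hS : MeasurableSet S) {c : ℝ}
    (h : ∀ u, P.real {ω | (u, V ω) ∈ S} ≤ c) :
    P.real {ω | (U ω, V ω) ∈ S} ≤ c := by
  obtain ⟨ω₀⟩ := P.nonempty_of_neZero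
  have hc : 0 ≤ c := measureReal_nonneg.trans (h (U ω₀))
  have : IsProbabilityMeasure (P.map U) := Measure.isProbabilityMeasure_map hU
  have fibre_le (u : α) : P.map V (Prod.mk u ⁻¹' S) ≤ ENNReal.ofReal c := by
    rw [Measure.map_apply_of_aemeasurable hV (measurable_prodMk_left hS)]
    exact (ENNReal.le_ofReal_iff_toReal_le (measure_ne_top _ _) hc).2 (h u)
  refine ENNReal.toReal_le_of_le_ofReal hc ?_
  calc P {ω | (U ω, V ω) ∈ S}
      = P.map (fun ω => (U ω, V ω)) S :=
        (Measure.map_apply_of_aemeasurable (hU.prodMk hV) hS).symm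
    _ = ∫⁻ u, P.map V (Prod.mk u ⁻¹' S) ∂P.map U := by
        rw [(indepFun_iff_map_prod_eq_prod_map_map hU hV).1 hUV, Measure.prod_apply hS]
    _ ≤ ∫⁻ _, ENNReal.ofReal c ∂P.map U := lintegral_mono fibre_le
    _ = ENNReal.ofReal c := by simp

lemma iIndepFun_rows {ι κ : Type*} [Finite ι] [Finite κ] {f : ι → κ → Ω → ℝ}
    (hf : ∀ i j, AEMeasurable (f i j) P) (h : iIndepFun (fun q : ι × κ => f q.1 q.2) P) :
    iIndepFun (fun i ω j => f i j ω) P := by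
  cases nonempty_fintype ι
  cases nonempty_fintype κ
  have := h.isProbabilityMeasure
  have (i : ι) (j : κ) : IsProbabilityMeasure (P.map (f i j)) :=
    Measure.isProbabilityMeasure_map (hf i j)
  have (i : ι) : IsProbabilityMeasure (P.map fun ω j => f i j ω) :=
    Measure.isProbabilityMeasure_map (aemeasurable_pi_lambda _ (hf i))
  have h_sigma : iIndepFun (fun q : (_ : ι) × κ => f q.1 q.2) P :=
    h.precomp (Equiv.sigmaEquivProd ι κ).injective
  have h_row (i : ι) : iIndepFun (f i) P :=
    h.precomp (g := fun j => (i, j)) (Prod.mk_right_injective i)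
  have curry_eq : (fun ω i j => f i j ω) =
      MeasurableEquiv.piCurry (fun (_ : ι) (_ : κ) => ℝ) ∘
        fun ω (q : (_ : ι) × κ) => f q.1 q.2 ω := by
    ext; simp [Sigma.curry]
  rw [iIndepFun_iff_map_fun_eq_pi_map (fun i => aemeasurable_pi_lambda _ (hf i)), curry_eq,
    ← AEMeasurable.map_map_of_aemeasurable (f := fun ω (q : (_ : ι) × κ) => f q.1 q.2 ω)
      (by fun_prop) (aemeasurable_pi_lambda _ fun q => hf q.1 q.2),
    h_sigma.map_fun_eq_pi_map (f := fun q : (_ : ι) × κ => f q.1 q.2) fun q => hf q.1 q.2,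
    ← Measure.infinitePi_eq_pi, Measure.infinitePi_map_piCurry fun i j => P.map (f i j),
    ← Measure.infinitePi_eq_pi]
  congr 1
  ext1 i
  rw [(h_row i).map_fun_eq_pi_map (hf i), Measure.infinitePi_eq_pi]

lemma indepFun_subfamilies {ι α β : Type*} [Finite α] [Finite β] {f : ι → Ω → ℝ}
    (hf : ∀ i, AEMeasurable (f i) P) (h : iIndepFun f P) (g₁ : α → ι) (g₂ : β → ι)
    (hg : ∀ a b, g₁ a ≠ g₂ b) :
    IndepFun (fun ω a => f (g₁ a) ω) (fun ω b => f (g₂ b) ω) P := by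
  classical
  cases nonempty_fintype α
  cases nonempty_fintype β
  have h_disjoint : Disjoint (Finset.univ.image g₁) (Finset.univ.image g₂) := by
    simpa [Finset.disjoint_left] using fun a b => (hg a b).symm
  exact (h.indepFun_finset₀ _ _ h_disjoint hf).comp
    (φ := fun z a => z ⟨g₁ a, Finset.mem_image_of_mem _ (Finset.mem_univ a)⟩)
    (ψ := fun z b => z ⟨g₂ b, Finset.mem_image_of_mem _ (Finset.mem_univ b)⟩)
    (measurable_pi_lambda _ fun _ => measurable_pi_apply _)
    (measurable_pi_lambda _ fun _ => measurable_pi_apply _)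

end Independence

lemma dotProduct_self_nonneg {κ : Type*} [Fintype κ] (u : κ → ℝ) : 0 ≤ u ⬝ᵥ u :=
  Finset.sum_nonneg fun _ _ => mul_self_nonneg _

section GaussianProjection

variable {Ω ι κ : Type*} [MeasurableSpace Ω] [Fintype ι] [Fintype κ] {P : Measure Ω}

lemma hasLaw_sum_mul_gaussian {g : κ → Ω → ℝ} {v : ℝ≥0}
    (hg : ∀ c, HasLaw (g c) (gaussianReal 0 v) P) (h : iIndepFun g P) (u : κ → ℝ) :
    HasLaw (fun ω => ∑ c, g c ω * u c) (gaussianReal 0 ((u ⬝ᵥ u).toNNReal * v)) P := by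
  have := h.isProbabilityMeasure
  have law_term (c : κ) : HasLaw (fun ω => g c ω * u c)
      (gaussianReal 0 (.mk (u c ^ 2) (sq_nonneg _) * v)) P := by
    simpa using gaussianReal_mul_const (hg c) (u c)
  have indep_terms : iIndepFun (fun c ω => g c ω * u c) P :=
    h.comp (fun c x => x * u c) fun c => by fun_prop
  have gaussian_sum : HasGaussianLaw (fun ω => ∑ c, g c ω * u c) P :=
    indep_terms.hasGaussianLaw_fun_sum fun c => (law_term c).hasGaussianLaw
  have memLp_term (c : κ) : MemLp (fun ω => g c ω * u c) 2 P :=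
    (law_term c).hasGaussianLaw.memLp_two
  have mean_sum : ∫ ω, ∑ c, g c ω * u c ∂P = 0 := by
    rw [integral_finsetSum _ fun c _ => (memLp_term c).integrable one_le_two]
    simp [(law_term _).integral_eq]
  have variance_sum : Var[fun ω => ∑ c, g c ω * u c; P] = (u ⬝ᵥ u) * v := by
    have := IndepFun.variance_sum (s := Finset.univ) (fun c _ => memLp_term c)
      fun c _ d _ hcd => indep_terms.indepFun hcd
    rw [Finset.sum_fn] at this
    simp [this, (law_term _).variance_eq, dotProduct, Finset.sum_mul, sq]
  refine ⟨gaussian_sum.aemeasurable, ?_⟩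
  rw [gaussian_sum.map_eq_gaussianReal, mean_sum, variance_sum,
    Real.toNNReal_mul (dotProduct_self_nonneg u), Real.toNNReal_coe]

lemma integral_exp_sq_gaussian (v : ℝ≥0) (l : ℝ) :
    ∫ x, Real.exp (l * x ^ 2) ∂(gaussianReal 0 v) = (√(1 - 2 * l * v))⁻¹ := by
  rcases eq_or_ne v 0 with rfl | hv
  · simp
  have density_mul_exp (x : ℝ) : gaussianPDFReal 0 v x • Real.exp (l * x ^ 2) =
      (√(2 * Real.pi * v))⁻¹ * Real.exp (-((1 - 2 * l * v) / (2 * v)) * x ^ 2) := by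
    rw [gaussianPDFReal, smul_eq_mul, mul_assoc, ← Real.exp_add]
    congr 2
    field_simp
    ring
  simp only [integral_gaussianReal_eq_integral_smul hv, density_mul_exp]
  rw [integral_const_mul, integral_gaussian, ← Real.sqrt_inv, ← Real.sqrt_inv,
    ← Real.sqrt_mul (by positivity)]
  congr 1
  field_simp

lemma inv_sqrt_one_sub_le {x : ℝ} (hx : |x| ≤ 1 / 3) :
    (√(1 - x))⁻¹ ≤ Real.exp (x / 2 + x ^ 2 / 2) := by
  have hx1 : 0 < 1 - x := by linarith [le_abs_self x]
  have log_ge : -(|x| ^ 3 / (1 - |x|)) ≤ x + x ^ 2 / 2 + Real.log (1 - x) := by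
    have := neg_le_of_abs_le (Real.abs_log_sub_add_sum_range_le (x := x) (by linarith) 2)
    norm_num [Finset.sum_range_succ] at this
    exact this
  have remainder_le : |x| ^ 3 / (1 - |x|) ≤ x ^ 2 / 2 := by
    rw [div_le_iff₀ (by linarith), ← sq_abs x]
    nlinarith [abs_nonneg x, sq_nonneg |x|]
  rw [← Real.exp_log hx1, ← Real.exp_half, ← Real.exp_neg]
  exact Real.exp_le_exp.2 (by linarith)

section ChiSquare

variable {Y : ι → Ω → ℝ} (law_Y : ∀ a, HasLaw (Y a) (gaussianReal 0 (Fintype.card ι : ℝ≥0)⁻¹) P)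
  (indep_Y : iIndepFun Y P)
include law_Y indep_Y

lemma mgf_sum_sq_gaussian (x : ℝ) :
    mgf (fun ω => ∑ a, Y a ω ^ 2) P (Fintype.card ι * x / 2) =
      (√(1 - x))⁻¹ ^ Fintype.card ι := by
  have mgf_term (a : ι) : mgf (fun ω => Y a ω ^ 2) P (Fintype.card ι * x / 2) =
      (√(1 - x))⁻¹ := by
    have : Nonempty ι := ⟨a⟩
    have key := integral_exp_sq_gaussian (Fintype.card ι : ℝ≥0)⁻¹ (Fintype.card ι * x / 2)
    rw [← (law_Y a).map_eq, integral_map (law_Y a).aemeasurable (by fun_prop)] at key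
    rw [mgf, key]
    congr 3
    push_cast
    field_simp
  have indep_sq : iIndepFun (fun a ω => Y a ω ^ 2) P :=
    indep_Y.comp (fun _ x => x ^ 2) fun _ => by fun_prop
  have := indep_sq.mgf_sum₀ (t := Fintype.card ι * x / 2)
    (fun a => (law_Y a).aemeasurable.pow_const 2) Finset.univ
  rw [Finset.sum_fn] at this
  rw [this, Finset.prod_congr rfl fun a _ => mgf_term a, Finset.prod_const, Finset.card_univ]

lemma integrable_exp_sum_sq_gaussian {x : ℝ} (hx : x < 1) :
    Integrable (fun ω => Real.exp (Fintype.card ι * x / 2 * ∑ a, Y a ω ^ 2)) P := by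
  by_contra h
  have mgf_eq := mgf_sum_sq_gaussian law_Y indep_Y x
  rw [mgf_undef h] at mgf_eq
  have : 0 < √(1 - x) := Real.sqrt_pos.2 (by linarith)
  exact absurd mgf_eq (by positivity)

lemma mgf_sum_sq_gaussian_le {x : ℝ} (hx : |x| ≤ 1 / 3) :
    mgf (fun ω => ∑ a, Y a ω ^ 2) P (Fintype.card ι * x / 2) ≤
      Real.exp (Fintype.card ι * (x / 2 + x ^ 2 / 2)) := by
  rw [mgf_sum_sq_gaussian law_Y indep_Y, Real.exp_nat_mul]
  gcongr
  exact inv_sqrt_one_sub_le hx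

lemma measureReal_sum_sq_gaussian_ge_le {s : ℝ} (hs0 : 0 ≤ s) (hs1 : s ≤ 1 / 2) :
    P.real {ω | 1 + s ≤ ∑ a, Y a ω ^ 2} ≤ Real.exp (-(Fintype.card ι * s ^ 2 / 8)) := by
  have := indep_Y.isProbabilityMeasure
  have abs_le_third : |s / 2| ≤ 1 / 3 := by rw [abs_of_nonneg (by positivity)]; linarith
  calc P.real {ω | 1 + s ≤ ∑ a, Y a ω ^ 2}
      ≤ Real.exp (-(Fintype.card ι * (s / 2) / 2) * (1 + s)) *
          mgf (fun ω => ∑ a, Y a ω ^ 2) P (Fintype.card ι * (s / 2) / 2) :=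
        measure_ge_le_exp_mul_mgf (1 + s) (by positivity)
          (integrable_exp_sum_sq_gaussian law_Y indep_Y (by linarith))
    _ ≤ Real.exp (-(Fintype.card ι * (s / 2) / 2) * (1 + s)) *
          Real.exp (Fintype.card ι * (s / 2 / 2 + (s / 2) ^ 2 / 2)) := by
        gcongr
        exact mgf_sum_sq_gaussian_le law_Y indep_Y abs_le_third
    _ = Real.exp (-(Fintype.card ι * s ^ 2 / 8)) := by rw [← Real.exp_add]; ring_nf

lemma measureReal_sum_sq_gaussian_le_le {s : ℝ} (hs0 : 0 ≤ s) (hs1 : s ≤ 1 / 2) :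
    P.real {ω | ∑ a, Y a ω ^ 2 ≤ 1 - s} ≤ Real.exp (-(Fintype.card ι * s ^ 2 / 8)) := by
  have := indep_Y.isProbabilityMeasure
  have abs_le_third : |-(s / 2)| ≤ 1 / 3 := by
    rw [abs_neg, abs_of_nonneg (by positivity)]; linarith
  have exponent_nonpos : Fintype.card ι * -(s / 2) / 2 ≤ 0 := by
    have : 0 ≤ Fintype.card ι * s := by positivity
    linarith
  calc P.real {ω | ∑ a, Y a ω ^ 2 ≤ 1 - s}
      ≤ Real.exp (-(Fintype.card ι * -(s / 2) / 2) * (1 - s)) *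
          mgf (fun ω => ∑ a, Y a ω ^ 2) P (Fintype.card ι * -(s / 2) / 2) :=
        measure_le_le_exp_mul_mgf (1 - s) exponent_nonpos
          (integrable_exp_sum_sq_gaussian law_Y indep_Y (by linarith))
    _ ≤ Real.exp (-(Fintype.card ι * -(s / 2) / 2) * (1 - s)) *
          Real.exp (Fintype.card ι * (-(s / 2) / 2 + (-(s / 2)) ^ 2 / 2)) := by
        gcongr
        exact mgf_sum_sq_gaussian_le law_Y indep_Y abs_le_third
    _ = Real.exp (-(Fintype.card ι * s ^ 2 / 8)) := by rw [← Real.exp_add]; ring_nf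

lemma measureReal_abs_sum_sq_gaussian_sub_one_ge_le {s : ℝ} (hs0 : 0 ≤ s) (hs1 : s ≤ 1 / 2) :
    P.real {ω | s ≤ |∑ a, Y a ω ^ 2 - 1|} ≤ 2 * Real.exp (-(Fintype.card ι * s ^ 2 / 8)) := by
  have := indep_Y.isProbabilityMeasure
  have subset_tails : {ω | s ≤ |∑ a, Y a ω ^ 2 - 1|} ⊆
      {ω | 1 + s ≤ ∑ a, Y a ω ^ 2} ∪ {ω | ∑ a, Y a ω ^ 2 ≤ 1 - s} := fun ω hω => by
    rcases le_abs.1 (show s ≤ |∑ a, Y a ω ^ 2 - 1| from hω) with h | h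
    · exact Or.inl (show 1 + s ≤ ∑ a, Y a ω ^ 2 by linarith)
    · exact Or.inr (show ∑ a, Y a ω ^ 2 ≤ 1 - s by linarith)
  linarith [measureReal_mono (μ := P) subset_tails,
    measureReal_union_le (μ := P) {ω | 1 + s ≤ ∑ a, Y a ω ^ 2} {ω | ∑ a, Y a ω ^ 2 ≤ 1 - s},
    measureReal_sum_sq_gaussian_ge_le law_Y indep_Y hs0 hs1,
    measureReal_sum_sq_gaussian_le_le law_Y indep_Y hs0 hs1]

end ChiSquare

/-- `A` preserves the inner product of `u` and `v` up to the error `s ‖u‖₂ ‖v‖₂`. -/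
def NearlyPreserves (A : Matrix ι κ ℝ) (s : ℝ) (u v : κ → ℝ) : Prop :=
  |(A *ᵥ u) ⬝ᵥ (A *ᵥ v) - u ⬝ᵥ v| ≤ s * (√(u ⬝ᵥ u) * √(v ⬝ᵥ v))

lemma nearlyPreserves_self_iff {A : Matrix ι κ ℝ} {s : ℝ} {u : κ → ℝ} :
    NearlyPreserves A s u u ↔ |(A *ᵥ u) ⬝ᵥ (A *ᵥ u) - u ⬝ᵥ u| ≤ s * (u ⬝ᵥ u) := by
  rw [NearlyPreserves, Real.mul_self_sqrt (dotProduct_self_nonneg u)]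

lemma NearlyPreserves.of_polarization {A : Matrix ι κ ℝ} {s : ℝ} {u v : κ → ℝ}
    (h_add : NearlyPreserves A s (√(v ⬝ᵥ v) • u + √(u ⬝ᵥ u) • v) (√(v ⬝ᵥ v) • u + √(u ⬝ᵥ u) • v))
    (h_sub : NearlyPreserves A s (√(v ⬝ᵥ v) • u - √(u ⬝ᵥ u) • v) (√(v ⬝ᵥ v) • u - √(u ⬝ᵥ u) • v)) :
    NearlyPreserves A s u v := by
  rcases eq_or_ne u 0 with rfl | hu
  · simp [NearlyPreserves]
  rcases eq_or_ne v 0 with rfl | hv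
  · simp [NearlyPreserves]
  have norm_u_pos : 0 < √(u ⬝ᵥ u) :=
    Real.sqrt_pos.2 ((dotProduct_self_nonneg u).lt_of_ne' (dotProduct_self_eq_zero.not.2 hu))
  have norm_v_pos : 0 < √(v ⬝ᵥ v) :=
    Real.sqrt_pos.2 ((dotProduct_self_nonneg v).lt_of_ne' (dotProduct_self_eq_zero.not.2 hv))
  have hu_sq := Real.sq_sqrt (dotProduct_self_nonneg u)
  have hv_sq := Real.sq_sqrt (dotProduct_self_nonneg v)
  rw [nearlyPreserves_self_iff] at h_add h_sub
  rw [NearlyPreserves]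
  generalize √(u ⬝ᵥ u) = x at *
  generalize √(v ⬝ᵥ v) = y at *
  simp only [Matrix.mulVec_add, Matrix.mulVec_sub, Matrix.mulVec_smul, dotProduct_add,
    add_dotProduct, dotProduct_sub, sub_dotProduct, smul_dotProduct, dotProduct_smul,
    smul_eq_mul, dotProduct_comm v u, dotProduct_comm (A *ᵥ v) (A *ᵥ u), ← hu_sq, ← hv_sq]
    at h_add h_sub
  have hxy : 0 < x * y := mul_pos norm_u_pos norm_v_pos
  refine le_of_mul_le_mul_left ?_ hxy
  rw [← abs_of_pos hxy, ← abs_mul, abs_of_pos hxy]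
  rw [abs_le] at h_add h_sub ⊢
  constructor <;> linarith [h_add.1, h_add.2, h_sub.1, h_sub.2]

/-- `R` is a Gaussian random projection: its entries are independent with law `𝒩(0, 1/m)`, where
`m` is the number of rows, so that `R` preserves inner products on average. -/
structure IsGaussianProjection (R : Ω → Matrix ι κ ℝ) (P : Measure Ω) : Prop where
  law : ∀ a c, HasLaw (fun ω => R ω a c) (gaussianReal 0 (Fintype.card ι : ℝ≥0)⁻¹) P
  indep : iIndepFun (fun (q : ι × κ) ω => R ω q.1 q.2) P

namespace IsGaussianProjection

variable {R : Ω → Matrix ι κ ℝ} (hR : IsGaussianProjection R P)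
include hR

lemma hasLaw_mulVec {u : κ → ℝ} (hu : u ⬝ᵥ u = 1) (a : ι) :
    HasLaw (fun ω => (R ω *ᵥ u) a) (gaussianReal 0 (Fintype.card ι : ℝ≥0)⁻¹) P := by
  have := hasLaw_sum_mul_gaussian (hR.law a)
    (hR.indep.precomp (g := fun c => (a, c)) (Prod.mk_right_injective a)) u
  rw [hu, Real.toNNReal_one, one_mul] at this
  exact this

lemma iIndepFun_mulVec (u : κ → ℝ) : iIndepFun (fun a ω => (R ω *ᵥ u) a) P :=
  (iIndepFun_rows (fun a c => (hR.law a c).aemeasurable) hR.indep).comp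
    (fun _ z => z ⬝ᵥ u) fun _ => by simp only [dotProduct]; fun_prop

lemma measureReal_not_nearlyPreserves_self_le (u : κ → ℝ) {s : ℝ} (hs0 : 0 ≤ s)
    (hs1 : s ≤ 1 / 2) :
    P.real {ω | ¬ NearlyPreserves (R ω) s u u} ≤ 2 * Real.exp (-(Fintype.card ι * s ^ 2 / 8)) := by
  have := hR.indep.isProbabilityMeasure
  simp only [nearlyPreserves_self_iff, not_le]
  rcases eq_or_ne u 0 with rfl | hu
  · simp only [Matrix.mulVec_zero, dotProduct_zero, sub_self, abs_zero, mul_zero, lt_irrefl,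
      Set.ofPred_false, measureReal_empty]
    positivity
  have huu : 0 < u ⬝ᵥ u :=
    (dotProduct_self_nonneg u).lt_of_ne' (dotProduct_self_eq_zero.not.2 hu)
  have norm_normalized : ((√(u ⬝ᵥ u))⁻¹ • u) ⬝ᵥ ((√(u ⬝ᵥ u))⁻¹ • u) = 1 := by
    rw [smul_dotProduct, dotProduct_smul, smul_eq_mul, smul_eq_mul, ← mul_assoc, ← mul_inv,
      Real.mul_self_sqrt huu.le, inv_mul_cancel₀ huu.ne']
  refine (measureReal_mono (fun ω hω => ?_) (measure_ne_top _ _)).trans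
    (measureReal_abs_sum_sq_gaussian_sub_one_ge_le (hR.hasLaw_mulVec norm_normalized)
      (hR.iIndepFun_mulVec _) hs0 hs1)
  have sum_sq_eq : ∑ a, (R ω *ᵥ ((√(u ⬝ᵥ u))⁻¹ • u)) a ^ 2 =
      (R ω *ᵥ u) ⬝ᵥ (R ω *ᵥ u) / (u ⬝ᵥ u) := by
    simp only [Matrix.mulVec_smul, Pi.smul_apply, smul_eq_mul, mul_pow, inv_pow,
      Real.sq_sqrt huu.le, ← Finset.mul_sum]
    rw [inv_mul_eq_div]
    simp only [sq, dotProduct]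
  rw [Set.mem_ofPred_eq] at hω ⊢
  rw [sum_sq_eq, div_sub_one huu.ne', abs_div, abs_of_pos huu, le_div_iff₀ huu]
  exact hω.le

lemma measureReal_not_nearlyPreserves_le (u v : κ → ℝ) {s : ℝ} (hs0 : 0 ≤ s) (hs1 : s ≤ 1 / 2) :
    P.real {ω | ¬ NearlyPreserves (R ω) s u v} ≤ 4 * Real.exp (-(Fintype.card ι * s ^ 2 / 8)) := by
  have := hR.indep.isProbabilityMeasure
  set z₁ := √(v ⬝ᵥ v) • u + √(u ⬝ᵥ u) • v
  set z₂ := √(v ⬝ᵥ v) • u - √(u ⬝ᵥ u) • v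
  have subset_union : {ω | ¬ NearlyPreserves (R ω) s u v} ⊆
      {ω | ¬ NearlyPreserves (R ω) s z₁ z₁} ∪ {ω | ¬ NearlyPreserves (R ω) s z₂ z₂} := by
    intro ω hω
    by_contra h
    simp only [Set.mem_union, Set.mem_ofPred_eq, not_or, not_not] at h
    exact hω (.of_polarization h.1 h.2)
  linarith [(measureReal_mono (μ := P) subset_union).trans (measureReal_union_le _ _),
    hR.measureReal_not_nearlyPreserves_self_le z₁ hs0 hs1,
    hR.measureReal_not_nearlyPreserves_self_le z₂ hs0 hs1]

lemma measureReal_not_nearlyPreserves_indep_le {U V : Ω → κ → ℝ}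
    (hU : AEMeasurable U P) (hV : AEMeasurable V P)
    (h : IndepFun (fun ω => (U ω, V ω)) (fun ω (q : ι × κ) => R ω q.1 q.2) P) {s : ℝ}
    (hs0 : 0 ≤ s) (hs1 : s ≤ 1 / 2) :
    P.real {ω | ¬ NearlyPreserves (R ω) s (U ω) (V ω)} ≤
      4 * Real.exp (-(Fintype.card ι * s ^ 2 / 8)) := by
  have := hR.indep.isProbabilityMeasure
  have measurableSet_not_nearlyPreserves :
      MeasurableSet {x : ((κ → ℝ) × (κ → ℝ)) × (ι × κ → ℝ) |
        ¬ NearlyPreserves (fun a c => x.2 (a, c)) s x.1.1 x.1.2} := by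
    simp only [NearlyPreserves, not_le, Matrix.mulVec, dotProduct]
    apply measurableSet_lt <;> fun_prop
  refine measureReal_prodMk_mem_le (c := 4 * Real.exp (-(Fintype.card ι * s ^ 2 / 8)))
    (hU.prodMk hV) (aemeasurable_pi_lambda _ fun q => (hR.law q.1 q.2).aemeasurable) h
    measurableSet_not_nearlyPreserves fun z => ?_
  simp only [Set.mem_ofPred_eq]
  exact hR.measureReal_not_nearlyPreserves_le z.1 z.2 hs0 hs1

end IsGaussianProjection

end GaussianProjection

section SymmetricTruncation

lemma integral_cond_le {α : Type*} [MeasurableSpace α] {μ : Measure α} [IsProbabilityMeasure μ]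
    {A : Set α} (hA : MeasurableSet A) (hA0 : μ A ≠ 0) {f : α → ℝ} (hf : Integrable f μ) {c : ℝ}
    (h_in : ∀ x ∈ A, f x ≤ c) (h_out : ∀ x ∉ A, c ≤ f x) :
    ∫ x, f x ∂μ[|A] ≤ ∫ x, f x ∂μ := by
  have hpos : 0 < μ.real A := ENNReal.toReal_pos hA0 (measure_ne_top _ _)
  have hle : μ.real A ≤ 1 := measureReal_le_one
  have cond_eq : ∫ x, f x ∂μ[|A] = (μ.real A)⁻¹ * ∫ x in A, f x ∂μ := by
    rw [ProbabilityTheory.cond, integral_smul_measure, ENNReal.toReal_inv, smul_eq_mul]; rfl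
  have le_inside : ∫ x in A, f x ∂μ ≤ c * μ.real A := by
    simpa [mul_comm] using
      setIntegral_mono_on hf.integrableOn (integrable_const c).integrableOn hA h_in
  have le_outside : c * (1 - μ.real A) ≤ ∫ x in Aᶜ, f x ∂μ := by
    rw [← probReal_compl_eq_one_sub hA]
    simpa [mul_comm] using
      setIntegral_mono_on (integrable_const c).integrableOn hf.integrableOn hA.compl h_out
  rw [cond_eq, inv_mul_le_iff₀ hpos, ← integral_add_compl hA hf]
  nlinarith [mul_le_mul_of_nonneg_left le_inside (sub_nonneg.2 hle),
    mul_le_mul_of_nonneg_left le_outside hpos.le]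

lemma integrable_cond {α : Type*} [MeasurableSpace α] {μ : Measure α} {A : Set α} {f : α → ℝ}
    (hf : Integrable f μ) (hA0 : μ A ≠ 0) : Integrable f μ[|A] :=
  hf.restrict.smul_measure (ENNReal.inv_ne_top.2 hA0)

variable {μ : Measure ℝ} {τ : ℝ}

lemma integral_cond_Icc_le [IsProbabilityMeasure μ] (hτ : μ (Set.Icc (-τ) τ) ≠ 0) {f : ℝ → ℝ}
    (hf : Integrable f μ) (f_mono : ∀ x y, |x| ≤ |y| → f x ≤ f y) :
    ∫ x, f x ∂μ[|Set.Icc (-τ) τ] ≤ ∫ x, f x ∂μ := by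
  have τ_nonneg : 0 ≤ τ := by
    by_contra! h
    exact hτ (by rw [Set.Icc_eq_empty (by linarith), measure_empty])
  refine integral_cond_le measurableSet_Icc hτ hf (c := f τ) (fun x hx => ?_) fun x hx => ?_
  · exact f_mono _ _ (by rw [abs_of_nonneg τ_nonneg]; exact abs_le.2 hx)
  · exact f_mono _ _ (by rw [abs_of_nonneg τ_nonneg]; exact (not_le.1 fun h => hx (abs_le.1 h)).le)

lemma isNegInvariant_cond_Icc [μ.IsNegInvariant] : (μ[|Set.Icc (-τ) τ]).IsNegInvariant := by
  have preimage_eq : Neg.neg ⁻¹' Set.Icc (-τ) τ = Set.Icc (-τ) τ := by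
    ext x; simp [and_comm]
  have restrict_map :=
    ((Measure.measurePreserving_neg μ).restrict_preimage (s := Set.Icc (-τ) τ)
      measurableSet_Icc).map_eq
  rw [preimage_eq] at restrict_map
  exact ⟨by rw [Measure.neg, ProbabilityTheory.cond, Measure.map_smul, restrict_map]⟩

lemma mgf_eq_integral_cosh [μ.IsNegInvariant]
    (h_exp : ∀ t, Integrable (fun x => Real.exp (t * x)) μ) (t : ℝ) :
    mgf id μ t = ∫ x, Real.cosh (t * x) ∂μ := by
  have symm : ∫ x, Real.exp (-t * x) ∂μ = ∫ x, Real.exp (t * x) ∂μ := by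
    simpa using integral_neg_eq_self (fun x => Real.exp (t * x)) μ
  simp only [Real.cosh_eq, ← neg_mul]
  rw [integral_div, integral_add (h_exp t) (h_exp (-t)), symm]
  simp [mgf]

/-- Symmetry turns the moment generating function into the integral of `cosh (t x)`, which
increases with `|x|`, so discarding the tails does not increase it. -/
lemma hasSubgaussianMGF_cond_Icc [IsProbabilityMeasure μ] [μ.IsNegInvariant] {c : ℝ≥0}
    (h : HasSubgaussianMGF id c μ) (hτ : μ (Set.Icc (-τ) τ) ≠ 0) :
    HasSubgaussianMGF id c μ[|Set.Icc (-τ) τ] := by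
  have := isNegInvariant_cond_Icc (μ := μ) (τ := τ)
  have integrable_cosh (t : ℝ) : Integrable (fun x => Real.cosh (t * x)) μ := by
    simp only [Real.cosh_eq, ← neg_mul]
    exact ((h.integrable_exp_mul t).add (h.integrable_exp_mul (-t))).div_const 2
  have integrable_exp_cond (t : ℝ) :
      Integrable (fun x => Real.exp (t * x)) μ[|Set.Icc (-τ) τ] :=
    integrable_cond (h.integrable_exp_mul t) hτ
  refine ⟨integrable_exp_cond, fun t => ?_⟩
  calc mgf id μ[|Set.Icc (-τ) τ] t
      = ∫ x, Real.cosh (t * x) ∂μ[|Set.Icc (-τ) τ] := mgf_eq_integral_cosh integrable_exp_cond t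
    _ ≤ ∫ x, Real.cosh (t * x) ∂μ := by
        refine integral_cond_Icc_le hτ (integrable_cosh t) fun x y hxy => ?_
        rw [Real.cosh_le_cosh, abs_mul, abs_mul]
        gcongr
    _ = mgf id μ t := (mgf_eq_integral_cosh h.integrable_exp_mul t).symm
    _ ≤ Real.exp (c * t ^ 2 / 2) := h.mgf_le t

end SymmetricTruncation

section TruncatedGaussian

lemma isNegInvariant_gaussianReal (v : ℝ≥0) : (gaussianReal 0 v).IsNegInvariant :=
  ⟨gaussianReal_map_neg.trans (by rw [neg_zero])⟩

lemma hasSubgaussianMGF_gaussianReal (v : ℝ≥0) : HasSubgaussianMGF id v (gaussianReal 0 v) :=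
  ⟨integrable_exp_mul_gaussianReal, fun t => by simp [mgf_id_gaussianReal]⟩

variable {σ τ : ℝ}

lemma gaussianReal_Icc_ne_zero (hσ : 0 < σ) (hτ : 0 < τ) :
    gaussianReal 0 (σ ^ 2).toNNReal (Set.Icc (-τ) τ) ≠ 0 := by
  intro h
  have hv : (σ ^ 2).toNNReal ≠ 0 := by simpa using hσ.ne'
  have volume_eq := gaussianReal_absolutelyContinuous' 0 hv h
  rw [Real.volume_Icc, ENNReal.ofReal_eq_zero] at volume_eq
  linarith

lemma hasSubgaussianMGF_truncGaussian (hσ : 0 < σ) (hτ : 0 < τ) :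
    HasSubgaussianMGF id (σ ^ 2).toNNReal (truncGaussian σ τ) :=
  have := isNegInvariant_gaussianReal (σ ^ 2).toNNReal
  hasSubgaussianMGF_cond_Icc (hasSubgaussianMGF_gaussianReal _) (gaussianReal_Icc_ne_zero hσ hτ)

lemma integrable_sq_gaussianReal (v : ℝ≥0) : Integrable (fun x => x ^ 2) (gaussianReal 0 v) :=
  (memLp_id_gaussianReal 2).integrable_sq

lemma integrable_sq_truncGaussian (hσ : 0 < σ) (hτ : 0 < τ) :
    Integrable (fun x => x ^ 2) (truncGaussian σ τ) :=
  integrable_cond (integrable_sq_gaussianReal _) (gaussianReal_Icc_ne_zero hσ hτ)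

lemma integral_sq_truncGaussian_le (hσ : 0 < σ) (hτ : 0 < τ) :
    ∫ x, x ^ 2 ∂truncGaussian σ τ ≤ σ ^ 2 :=
  calc ∫ x, x ^ 2 ∂truncGaussian σ τ
      ≤ ∫ x, x ^ 2 ∂gaussianReal 0 (σ ^ 2).toNNReal :=
        integral_cond_Icc_le (gaussianReal_Icc_ne_zero hσ hτ) (integrable_sq_gaussianReal _)
          fun _ _ => sq_le_sq.2
    _ = Var[fun x => x; gaussianReal 0 (σ ^ 2).toNNReal] :=
        (variance_of_integral_eq_zero (by fun_prop) (by simp)).symm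
    _ = σ ^ 2 := by rw [variance_fun_id_gaussianReal, Real.coe_toNNReal _ (sq_nonneg σ)]

end TruncatedGaussian

section SubgaussianVectors

variable {Ω ι : Type*} [MeasurableSpace Ω] [Fintype ι] {P : Measure Ω}

lemma measureReal_abs_sum_ge_le {Y : ι → Ω → ℝ} (h : iIndepFun Y P) {c : ι → ℝ≥0}
    (hY : ∀ i, HasSubgaussianMGF (Y i) (c i) P) {ε : ℝ} (hε : 0 ≤ ε) :
    P.real {ω | ε ≤ |∑ i, Y i ω|} ≤ 2 * Real.exp (-ε ^ 2 / (2 * ∑ i, (c i : ℝ))) := by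
  have := h.isProbabilityMeasure
  have h_sum := HasSubgaussianMGF.sum_of_iIndepFun h (s := Finset.univ) fun i _ => hY i
  have upper := h_sum.measure_ge_le hε
  have lower := h_sum.neg.measure_ge_le hε
  push_cast at upper lower
  simp only [Pi.neg_apply] at lower
  have subset_tails : {ω | ε ≤ |∑ i, Y i ω|} ⊆
      {ω | ε ≤ ∑ i, Y i ω} ∪ {ω | ε ≤ -∑ i, Y i ω} :=
    fun ω hω => le_abs.1 (show ε ≤ |∑ i, Y i ω| from hω)
  linarith [(measureReal_mono (μ := P) subset_tails).trans (measureReal_union_le _ _)]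

lemma measureReal_abs_dotProduct_gt_le {ξ : Ω → ι → ℝ} {c : ℝ≥0} (hc : 0 < c)
    (h_sub : ∀ i, HasSubgaussianMGF (fun ω => ξ ω i) c P) (h : iIndepFun (fun i ω => ξ ω i) P)
    {l : ℝ} (hl : 0 ≤ l) (x : ι → ℝ) :
    P.real {ω | 2 * √c * √l * √(x ⬝ᵥ x) < |x ⬝ᵥ ξ ω|} ≤ 2 * Real.exp (-(2 * l)) := by
  have := h.isProbabilityMeasure
  rcases eq_or_ne x 0 with rfl | hx
  · simp only [zero_dotProduct, Real.sqrt_zero, mul_zero, abs_zero, lt_irrefl, Set.ofPred_false,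
      measureReal_empty]
    positivity
  have hxx : 0 < x ⬝ᵥ x :=
    (dotProduct_self_nonneg x).lt_of_ne' (dotProduct_self_eq_zero.not.2 hx)
  have proxy_sum : ∑ i, ((.mk (x i ^ 2) (sq_nonneg _) * c : ℝ≥0) : ℝ) = (x ⬝ᵥ x) * c := by
    simp [dotProduct, Finset.sum_mul, sq]
  calc P.real {ω | 2 * √c * √l * √(x ⬝ᵥ x) < |x ⬝ᵥ ξ ω|}
      ≤ P.real {ω | 2 * √c * √l * √(x ⬝ᵥ x) ≤ |∑ i, x i * ξ ω i|} :=
        measureReal_mono fun ω hω =>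
          (show 2 * √c * √l * √(x ⬝ᵥ x) < |∑ i, x i * ξ ω i| from hω).le
    _ ≤ 2 * Real.exp (-(2 * √c * √l * √(x ⬝ᵥ x)) ^ 2 / (2 * ((x ⬝ᵥ x) * c))) :=
        proxy_sum ▸ measureReal_abs_sum_ge_le (h.comp (fun i y => x i * y) fun i => by fun_prop)
          (fun i => (h_sub i).const_mul (x i)) (by positivity)
    _ = 2 * Real.exp (-(2 * l)) := by
        rw [mul_pow, mul_pow, mul_pow, Real.sq_sqrt hl, Real.sq_sqrt hxx.le,
          Real.sq_sqrt c.coe_nonneg]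
        field_simp

lemma measureReal_abs_dotProduct_indep_gt_le {ξ U : Ω → ι → ℝ} {c : ℝ≥0} (hc : 0 < c)
    (h_sub : ∀ i, HasSubgaussianMGF (fun ω => ξ ω i) c P) (h : iIndepFun (fun i ω => ξ ω i) P)
    (hU : AEMeasurable U P) (hUξ : IndepFun U ξ P) {l : ℝ} (hl : 0 ≤ l) :
    P.real {ω | 2 * √c * √l * √(U ω ⬝ᵥ U ω) < |U ω ⬝ᵥ ξ ω|} ≤ 2 * Real.exp (-(2 * l)) := by
  have := h.isProbabilityMeasure
  have measurableSet_gt : MeasurableSet {x : (ι → ℝ) × (ι → ℝ) |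
      2 * √c * √l * √(x.1 ⬝ᵥ x.1) < |x.1 ⬝ᵥ x.2|} := by
    simp only [dotProduct]
    apply measurableSet_lt <;> fun_prop
  exact measureReal_prodMk_mem_le hU (aemeasurable_pi_lambda _ fun i => (h_sub i).aemeasurable)
    hUξ measurableSet_gt fun x => measureReal_abs_dotProduct_gt_le hc h_sub h hl x

lemma measureReal_dotProduct_self_gt_le [IsFiniteMeasure P] [Nonempty ι] {ξ : Ω → ι → ℝ} {v : ℝ}
    (hv : 0 < v) (h_int : ∀ i, Integrable (fun ω => ξ ω i ^ 2) P)
    (h_le : ∀ i, ∫ ω, ξ ω i ^ 2 ∂P ≤ v) {l : ℝ} (hl : 0 < l) :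
    P.real {ω | Fintype.card ι * v * l < ξ ω ⬝ᵥ ξ ω} ≤ 1 / l := by
  have dot_eq (ω : Ω) : ξ ω ⬝ᵥ ξ ω = ∑ i, ξ ω i ^ 2 := by simp [dotProduct, sq]
  have integral_le : ∫ ω, ξ ω ⬝ᵥ ξ ω ∂P ≤ Fintype.card ι * v := by
    simp only [dot_eq]
    rw [integral_finsetSum _ fun i _ => h_int i]
    simpa using Finset.sum_le_sum fun i (_ : i ∈ Finset.univ) => h_le i
  have markov := mul_meas_ge_le_integral_of_nonneg (μ := P) (f := fun ω => ξ ω ⬝ᵥ ξ ω)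
    (ae_of_all _ fun ω => dotProduct_self_nonneg _)
    (by simp only [dot_eq]; exact integrable_finsetSum _ fun i _ => h_int i)
    (Fintype.card ι * v * l)
  have hpos : 0 < Fintype.card ι * v := by positivity
  refine (measureReal_mono (μ := P) (s₂ := {ω | Fintype.card ι * v * l ≤ ξ ω ⬝ᵥ ξ ω}) fun ω hω =>
    (show Fintype.card ι * v * l < ξ ω ⬝ᵥ ξ ω from hω).le).trans ?_
  rw [le_div_iff₀ hl]
  refine le_of_mul_le_mul_left ?_ hpos
  linarith

end SubgaussianVectors

section EmpiricalCovariance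

/-- The deviation `(1/n) AᵀA - φ I` of a normalized Gram matrix from a multiple of the identity. -/
noncomputable def gramError {m κ : Type*} [Fintype m] [DecidableEq κ] (n : ℕ) (φ : ℝ)
    (A : Matrix m κ ℝ) : Matrix κ κ ℝ :=
  (1 / (n : ℝ)) • (Aᵀ * A) - φ • 1

lemma IsDesignLaw.ae_abs_le {Ω : Type*} [MeasurableSpace Ω] {P : Measure Ω} {𝒟 : Measure ℝ} {b : ℝ}
    (h𝒟 : IsDesignLaw 𝒟 b) {Y : Ω → ℝ} (hY : HasLaw Y 𝒟 P) : ∀ᵐ ω ∂P, |Y ω| ≤ b := by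
  have abs_le_𝒟 : ∀ᵐ x ∂P.map Y, |x| ≤ b := by
    rw [hY.map_eq]
    filter_upwards [ae_iff.2 h𝒟.support] with x hx using abs_le.2 hx
  exact ae_of_ae_map hY.aemeasurable abs_le_𝒟

lemma IsDesignLaw.integral_mul_self {Ω : Type*} [MeasurableSpace Ω] {P : Measure Ω}
    {𝒟 : Measure ℝ} {b : ℝ} (h𝒟 : IsDesignLaw 𝒟 b) {Y : Ω → ℝ} (hY : HasLaw Y 𝒟 P) :
    ∫ ω, Y ω * Y ω ∂P = 1 := by
  have mean_Y : ∫ ω, Y ω ∂P = 0 := hY.integral_eq.trans h𝒟.mean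
  have variance_Y : Var[Y; P] = 1 := hY.variance_eq.trans h𝒟.variance
  rw [variance_of_integral_eq_zero hY.aemeasurable mean_Y] at variance_Y
  simpa only [sq] using variance_Y

section

variable {Ω κ : Type*} [MeasurableSpace Ω] [DecidableEq κ] {P : Measure Ω} {n : ℕ}
  {𝒟 : Measure ℝ} {b : ℝ} (h𝒟 : IsDesignLaw 𝒟 b) {X : Ω → Matrix (Fin n) κ ℝ}
  (law_X : ∀ i j, HasLaw (fun ω => X ω i j) 𝒟 P)
  (indep_X : iIndepFun (fun (q : Fin n × κ) ω => X ω q.1 q.2) P)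
include h𝒟 law_X indep_X

lemma integral_design_mul_design (i : Fin n) (j k : κ) :
    ∫ ω, X ω i j * X ω i k ∂P = (1 : Matrix κ κ ℝ) j k := by
  rcases eq_or_ne j k with rfl | hjk
  · rw [h𝒟.integral_mul_self (law_X i j), Matrix.one_apply_eq]
  · have indep_entries : IndepFun (fun ω => X ω i j) (fun ω => X ω i k) P :=
      indep_X.indepFun (i := (i, j)) (j := (i, k)) (by simpa using hjk)
    rw [indep_entries.integral_fun_mul_eq_mul_integral (law_X i j).aemeasurable.aestronglyMeasurable
      (law_X i k).aemeasurable.aestronglyMeasurable, (law_X i j).integral_eq, h𝒟.mean, zero_mul,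
      Matrix.one_apply_ne hjk]

lemma hasSubgaussianMGF_design_mul_design (i : Fin n) (j k : κ) :
    HasSubgaussianMGF (fun ω => X ω i j * X ω i k - (1 : Matrix κ κ ℝ) j k)
      ((b ^ 2 + 1) ^ 2).toNNReal P := by
  have := indep_X.isProbabilityMeasure
  have abs_mul_le : ∀ᵐ ω ∂P, |X ω i j * X ω i k| ≤ b ^ 2 := by
    filter_upwards [h𝒟.ae_abs_le (law_X i j), h𝒟.ae_abs_le (law_X i k)] with ω hj hk
    rw [abs_mul, sq]
    exact mul_le_mul hj hk (abs_nonneg _) ((abs_nonneg _).trans hj)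
  have aemeasurable_mul : AEMeasurable (fun ω => X ω i j * X ω i k) P :=
    (law_X i j).aemeasurable.mul (law_X i k).aemeasurable
  have mean_zero : ∫ ω, X ω i j * X ω i k - (1 : Matrix κ κ ℝ) j k ∂P = 0 := by
    rw [integral_sub (.of_bound aemeasurable_mul.aestronglyMeasurable (b ^ 2) abs_mul_le)
      (integrable_const _), integral_design_mul_design h𝒟 law_X indep_X]
    simp
  have mem_Icc : ∀ᵐ ω ∂P, X ω i j * X ω i k - (1 : Matrix κ κ ℝ) j k ∈
      Set.Icc (-(b ^ 2 + 1)) (b ^ 2 + 1) := by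
    have one_apply_mem : 0 ≤ (1 : Matrix κ κ ℝ) j k ∧ (1 : Matrix κ κ ℝ) j k ≤ 1 := by
      rw [Matrix.one_apply]; split_ifs <;> simp
    filter_upwards [abs_mul_le] with ω hω
    rw [abs_le] at hω
    constructor <;> linarith
  convert hasSubgaussianMGF_of_mem_Icc_of_integral_eq_zero (aemeasurable_mul.sub_const _) mem_Icc
    mean_zero using 1
  ext
  rw [Real.coe_toNNReal _ (by positivity)]
  push_cast
  rw [Real.norm_eq_abs, sub_neg_eq_add, abs_of_pos (by positivity)]
  ring

lemma measureReal_abs_gramError_gt_le [Finite κ] (hn : 0 < n) {l : ℝ} (hl : 0 ≤ l) (j k : κ) :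
    P.real {ω | 3 * (b ^ 2 + 1) * √(l / n) < |gramError n 1 (X ω) j k|} ≤
      2 * Real.exp (-(4 * l)) := by
  have := indep_X.isProbabilityMeasure
  have hn' : (0 : ℝ) < n := by exact_mod_cast hn
  let W : Fin n → Ω → ℝ := fun i ω => X ω i j * X ω i k - (1 : Matrix κ κ ℝ) j k
  have indep_W : iIndepFun W P :=
    (iIndepFun_rows (fun i j => (law_X i j).aemeasurable) indep_X).comp
      (fun _ z => z j * z k - (1 : Matrix κ κ ℝ) j k) fun _ => by fun_prop
  have gramError_eq (ω : Ω) : gramError n 1 (X ω) j k = (∑ i, W i ω) / n := by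
    simp only [gramError, one_smul, Matrix.sub_apply, Matrix.smul_apply, Matrix.mul_apply,
      Matrix.transpose_apply, smul_eq_mul, W, Finset.sum_sub_distrib, Finset.sum_const,
      Finset.card_univ, Fintype.card_fin, nsmul_eq_mul]
    field_simp
  calc P.real {ω | 3 * (b ^ 2 + 1) * √(l / n) < |gramError n 1 (X ω) j k|}
      ≤ P.real {ω | n * (3 * (b ^ 2 + 1) * √(l / n)) ≤ |∑ i, W i ω|} := by
        refine measureReal_mono fun ω hω => ?_
        rw [Set.mem_ofPred_eq, gramError_eq, abs_div, abs_of_pos hn', lt_div_iff₀' hn'] at hω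
        exact hω.le
    _ ≤ 2 * Real.exp (-(n * (3 * (b ^ 2 + 1) * √(l / n))) ^ 2 /
          (2 * ∑ _i : Fin n, (((b ^ 2 + 1) ^ 2).toNNReal : ℝ))) :=
        measureReal_abs_sum_ge_le indep_W
          (fun i => hasSubgaussianMGF_design_mul_design h𝒟 law_X indep_X i j k) (by positivity)
    _ = 2 * Real.exp (-(9 / 2 * l)) := by
        simp only [Finset.sum_const, Finset.card_univ, Fintype.card_fin, nsmul_eq_mul]
        rw [Real.coe_toNNReal _ (by positivity), mul_pow, mul_pow, mul_pow,
          Real.sq_sqrt (by positivity)]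
        field_simp
        ring_nf
    _ ≤ 2 * Real.exp (-(4 * l)) := by gcongr; norm_num

end

end EmpiricalCovariance

/-- The stacked design `[X; w I; 0]`, which the projection `R` compresses to `X*`. -/
def stackedDesign {n p : ℕ} (X : Matrix (Fin n) (Fin p) ℝ) (w : ℝ) :
    Matrix (Cols n p) (Fin p) ℝ :=
  Matrix.fromRows X (Matrix.fromRows (w • (1 : Matrix (Fin p) (Fin p) ℝ)) 0)

/-- The stacked noise `[ξ; -w θ₀; w]`, which `R` compresses to the noise `y* - X* θ₀` of the private
regression. -/
def stackedNoise {n p : ℕ} (ξ : Fin n → ℝ) (w : ℝ) (θ₀ : Fin p → ℝ) : Cols n p → ℝ :=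
  Sum.elim ξ (Sum.elim (-(w • θ₀)) fun _ => w)

section StackedRegression

variable {n p r : ℕ} (R : Matrix (Fin r) (Cols n p) ℝ) (X : Matrix (Fin n) (Fin p) ℝ)
  (ξ : Fin n → ℝ) (w : ℝ) (θ₀ θhat : Fin p → ℝ)

lemma stackedDesign_mulVec (v : Fin p → ℝ) :
    stackedDesign X w *ᵥ v = Sum.elim (X *ᵥ v) (Sum.elim (w • v) 0) := by
  rw [stackedDesign, Matrix.fromRows_mulVec, Matrix.fromRows_mulVec, Matrix.smul_mulVec,
    Matrix.one_mulVec, Matrix.zero_mulVec]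

lemma transpose_stackedDesign :
    (stackedDesign X w)ᵀ = Matrix.fromCols Xᵀ (Matrix.fromCols (w • 1) 0) := by
  rw [stackedDesign, Matrix.transpose_fromRows, Matrix.transpose_fromRows, Matrix.transpose_smul,
    Matrix.transpose_one, Matrix.transpose_zero]

lemma transpose_stackedDesign_mul_self :
    (stackedDesign X w)ᵀ * stackedDesign X w = Xᵀ * X + w ^ 2 • 1 := by
  rw [transpose_stackedDesign, stackedDesign, Matrix.fromCols_mul_fromRows,
    Matrix.fromCols_mul_fromRows, Matrix.smul_mul, Matrix.one_mul, smul_smul, Matrix.zero_mul,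
    add_zero, sq]

lemma transpose_stackedDesign_mulVec_stackedNoise :
    (stackedDesign X w)ᵀ *ᵥ stackedNoise ξ w θ₀ = Xᵀ *ᵥ ξ - w ^ 2 • θ₀ := by
  rw [transpose_stackedDesign, stackedNoise, Matrix.fromCols_mulVec_sumElim,
    Matrix.fromCols_mulVec_sumElim, Matrix.smul_mulVec, Matrix.one_mulVec, Matrix.zero_mulVec,
    smul_neg, smul_smul, add_zero, ← sub_eq_add_neg, sq]

lemma stackedNoise_dotProduct_self :
    stackedNoise ξ w θ₀ ⬝ᵥ stackedNoise ξ w θ₀ = ξ ⬝ᵥ ξ + w ^ 2 * (θ₀ ⬝ᵥ θ₀) + w ^ 2 := by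
  simp only [stackedNoise, sumElim_dotProduct_sumElim, neg_dotProduct_neg, smul_dotProduct,
    dotProduct_smul, smul_eq_mul]
  simp only [dotProduct, Finset.univ_unique, Finset.sum_const, Finset.card_singleton, one_smul]
  ring

lemma privX_eq_mul_stackedDesign (y : Fin n → ℝ) : privX R X y w = R * stackedDesign X w := by
  ext a j
  simp only [privX, release, Matrix.toCols₁_apply, Matrix.mul_apply, stackedDesign]
  refine Finset.sum_congr rfl fun c _ => ?_
  rcases c with i | k | z <;> simp [Matrix.one_apply]

lemma privY_eq_mulVec (y : Fin n → ℝ) :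
    privY R X y w = R *ᵥ Sum.elim y (Sum.elim 0 fun _ => w) := by
  ext a
  simp only [privY, release, Matrix.toCols₂_apply, Matrix.mul_apply, Matrix.mulVec, dotProduct]
  refine Finset.sum_congr rfl fun c _ => ?_
  rcases c with i | k | z
  · simp
  · simp
  · simp [Subsingleton.elim z 0]

lemma privY_sub_privX_mulVec :
    privY R X (response X θ₀ ξ) w - privX R X (response X θ₀ ξ) w *ᵥ θ₀ =
      R *ᵥ stackedNoise ξ w θ₀ := by
  rw [privY_eq_mulVec, privX_eq_mul_stackedDesign, ← Matrix.mulVec_mulVec, ← Matrix.mulVec_sub,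
    stackedDesign_mulVec]
  congr 1
  ext c
  rcases c with i | k | z <;> simp [stackedNoise, response]

lemma gramError_mul_stackedDesign :
    gramError n (phi n w) (R * stackedDesign X w) = gramError n 1 X +
      (1 / (n : ℝ)) • ((stackedDesign X w)ᵀ * ((Rᵀ * R - 1) * stackedDesign X w)) := by
  have gram_eq : (R * stackedDesign X w)ᵀ * (R * stackedDesign X w) =
      (stackedDesign X w)ᵀ * ((Rᵀ * R - 1) * stackedDesign X w) + (Xᵀ * X + w ^ 2 • 1) := by
    rw [← transpose_stackedDesign_mul_self, Matrix.sub_mul, Matrix.mul_sub, Matrix.one_mul,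
      sub_add_cancel, Matrix.transpose_mul, Matrix.mul_assoc, Matrix.mul_assoc]
  rw [gramError, gramError, gram_eq, phi]
  module

lemma score_add_shift_eq :
    (1 / (n : ℝ)) • ((R * stackedDesign X w)ᵀ *ᵥ (R *ᵥ stackedNoise ξ w θ₀)) + (w ^ 2 / n) • θ₀ =
      (1 / (n : ℝ)) • ((stackedDesign X w)ᵀ *ᵥ ((Rᵀ * R - 1) *ᵥ stackedNoise ξ w θ₀)) +
        (1 / (n : ℝ)) • (Xᵀ *ᵥ ξ) := by
  rw [Matrix.sub_mulVec, Matrix.mulVec_sub, Matrix.one_mulVec,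
    transpose_stackedDesign_mulVec_stackedNoise, Matrix.transpose_mul, ← Matrix.mulVec_mulVec,
    ← Matrix.mulVec_mulVec]
  module

lemma bias_eq_gramError_mulVec_add :
    bias R X w θ₀ θhat = gramError n (phi n w) (R * stackedDesign X w) *ᵥ (θ₀ - θhat) +
      (1 / (n : ℝ)) • ((stackedDesign X w)ᵀ *ᵥ ((Rᵀ * R - 1) *ᵥ stackedNoise 0 w θ₀)) := by
  have residual_eq : Sum.elim (X *ᵥ (θ₀ - θhat)) (Sum.elim (-(w • θhat)) fun _ => w) =
      stackedDesign X w *ᵥ (θ₀ - θhat) + stackedNoise 0 w θ₀ := by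
    rw [stackedDesign_mulVec]
    ext c
    rcases c with i | k | z
    · simp [stackedNoise]
    · simp only [stackedNoise, Sum.elim_inr, Sum.elim_inl, Pi.add_apply, Pi.neg_apply,
        Pi.smul_apply, Pi.sub_apply, smul_eq_mul]
      ring
    · simp [stackedNoise]
  rw [gramError_mul_stackedDesign, bias, ← transpose_stackedDesign, residual_eq, gramError,
    one_smul, Matrix.add_mulVec, Matrix.mulVec_add, smul_add, Matrix.smul_mulVec _ (_ * _),
    ← add_assoc]
  simp only [Matrix.mulVec_mulVec, Matrix.mul_assoc]

end StackedRegression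

section ProjectionError

variable {ι κ : Type*} [Fintype ι] [Fintype κ] [DecidableEq κ] (R : Matrix ι κ ℝ)

lemma dotProduct_transpose_mul_self_sub_one_mulVec (u v : κ → ℝ) :
    u ⬝ᵥ ((Rᵀ * R - 1) *ᵥ v) = (R *ᵥ u) ⬝ᵥ (R *ᵥ v) - u ⬝ᵥ v := by
  rw [Matrix.sub_mulVec, Matrix.one_mulVec, dotProduct_sub, ← Matrix.mulVec_mulVec,
    Matrix.dotProduct_mulVec, Matrix.vecMul_transpose]

variable {R} in
lemma NearlyPreserves.abs_dotProduct_le {s : ℝ} {u v : κ → ℝ} (h : NearlyPreserves R s u v) :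
    |u ⬝ᵥ ((Rᵀ * R - 1) *ᵥ v)| ≤ s * (√(u ⬝ᵥ u) * √(v ⬝ᵥ v)) := by
  rw [dotProduct_transpose_mul_self_sub_one_mulVec]
  exact h

end ProjectionError

section Lasso

lemma norm_toLp_two_sq {ι : Type*} [Fintype ι] (x : ι → ℝ) : ‖WithLp.toLp 2 x‖ ^ 2 = x ⬝ᵥ x := by
  rw [EuclideanSpace.real_norm_sq_eq]; simp [dotProduct, sq]

lemma abs_dotProduct_mulVec_self_le {κ : Type*} [Fintype κ] {M : Matrix κ κ ℝ} {D : ℝ}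
    (hM : ∀ j k, |M j k| ≤ D) (u : κ → ℝ) : |u ⬝ᵥ (M *ᵥ u)| ≤ D * (∑ j, |u j|) ^ 2 := by
  simp only [dotProduct, Matrix.mulVec, Finset.mul_sum]
  calc |∑ j, ∑ k, u j * (M j k * u k)| ≤ ∑ j, ∑ k, |u j * (M j k * u k)| :=
        (Finset.abs_sum_le_sum_abs _ _).trans
          (Finset.sum_le_sum fun j _ => Finset.abs_sum_le_sum_abs _ _)
    _ ≤ ∑ j, ∑ k, D * (|u j| * |u k|) := by
        gcongr with j _ k
        rw [abs_mul, abs_mul, mul_left_comm]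
        gcongr
        exact hM j k
    _ = D * (∑ j, |u j|) ^ 2 := by
        rw [sq, Finset.sum_mul_sum, Finset.mul_sum]
        simp only [Finset.mul_sum]

lemma mul_dotProduct_self_sub_le {m κ : Type*} [Fintype m] [Fintype κ] [DecidableEq κ] {n : ℕ}
    {A : Matrix m κ ℝ} {φ D : ℝ} (hD : ∀ j k, |gramError n φ A j k| ≤ D) (u : κ → ℝ) :
    φ * (u ⬝ᵥ u) - D * (∑ j, |u j|) ^ 2 ≤ 1 / n * ((A *ᵥ u) ⬝ᵥ (A *ᵥ u)) := by
  have quadratic_eq :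
      u ⬝ᵥ (gramError n φ A *ᵥ u) = 1 / n * ((A *ᵥ u) ⬝ᵥ (A *ᵥ u)) - φ * (u ⬝ᵥ u) := by
    rw [gramError, Matrix.sub_mulVec, Matrix.smul_mulVec, Matrix.smul_mulVec, Matrix.one_mulVec,
      dotProduct_sub, dotProduct_smul, dotProduct_smul, ← Matrix.mulVec_mulVec,
      Matrix.dotProduct_mulVec, Matrix.vecMul_transpose, smul_eq_mul, smul_eq_mul]
  linarith [(abs_le.1 (quadratic_eq ▸ abs_dotProduct_mulVec_self_le hD u)).1]

lemma dotProduct_le_of_abs_add_smul_le {κ : Type*} [Fintype κ] {g θ₀ : κ → ℝ} {a t : ℝ}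
    (ht : 0 ≤ t) (hθ₀ : θ₀ ⬝ᵥ θ₀ ≤ 1) (hg : ∀ j, |g j + t * θ₀ j| ≤ a) (u : κ → ℝ) :
    u ⬝ᵥ g ≤ a * ∑ j, |u j| + t * √(u ⬝ᵥ u) := by
  have cauchy_schwarz : -(u ⬝ᵥ θ₀) ≤ √(u ⬝ᵥ u) := by
    refine Real.le_sqrt_of_sq_le ?_
    have sq_le : (u ⬝ᵥ θ₀) ^ 2 ≤ (u ⬝ᵥ u) * (θ₀ ⬝ᵥ θ₀) := by
      simpa only [dotProduct, sq] using Finset.sum_mul_sq_le_sq_mul_sq Finset.univ u θ₀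
    nlinarith [dotProduct_self_nonneg u]
  have shifted_le : u ⬝ᵥ (g + t • θ₀) ≤ a * ∑ j, |u j| := by
    rw [dotProduct, Finset.mul_sum]
    refine Finset.sum_le_sum fun j _ => (le_abs_self _).trans ?_
    rw [abs_mul, mul_comm]
    exact mul_le_mul_of_nonneg_right (hg j) (abs_nonneg _)
  rw [dotProduct_add, dotProduct_smul, smul_eq_mul] at shifted_le
  linarith [mul_le_mul_of_nonneg_left cauchy_schwarz ht]

variable {n p r : ℕ} {A : Matrix (Fin r) (Fin p) ℝ} {z : Fin r → ℝ} {lam : ℝ}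
  {θ₀ θhat : Fin p → ℝ}

lemma lasso_basic_inequality (h : lassoObj n A z lam θhat ≤ lassoObj n A z lam θ₀) :
    1 / 2 * (1 / n * ((A *ᵥ (θhat - θ₀)) ⬝ᵥ (A *ᵥ (θhat - θ₀)))) + lam * ∑ j, |θhat j| ≤
      (θhat - θ₀) ⬝ᵥ ((1 / (n : ℝ)) • (Aᵀ *ᵥ (z - A *ᵥ θ₀))) + lam * ∑ j, |θ₀ j| := by
  simp only [lassoObj, norm_toLp_two_sq, PiLp.norm_eq_of_L1, Real.norm_eq_abs] at h
  have residual_θhat : A *ᵥ θhat - z = A *ᵥ (θhat - θ₀) - (z - A *ᵥ θ₀) := by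
    rw [Matrix.mulVec_sub]; abel
  have residual_θ₀ : A *ᵥ θ₀ - z = -(z - A *ᵥ θ₀) := by abel
  have expand_sq (d e : Fin r → ℝ) : (d - e) ⬝ᵥ (d - e) = d ⬝ᵥ d - 2 * (d ⬝ᵥ e) + e ⬝ᵥ e := by
    rw [sub_dotProduct, dotProduct_sub, dotProduct_sub, dotProduct_comm e d]; ring
  rw [residual_θhat, residual_θ₀, expand_sq, neg_dotProduct_neg, one_div, mul_inv] at h
  rw [dotProduct_smul, Matrix.dotProduct_mulVec (θhat - θ₀), Matrix.vecMul_transpose, smul_eq_mul,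
    one_div, one_div]
  linarith

lemma l1_sub_l1_le (θ₀ θ : Fin p → ℝ) :
    ∑ j, |θ₀ j| - ∑ j, |θ j| ≤
      2 * (√(sparsity θ₀ : ℝ) * √((θ - θ₀) ⬝ᵥ (θ - θ₀))) - ∑ j, |(θ - θ₀) j| := by
  classical
  let S : Finset (Fin p) := {j | θ₀ j ≠ 0}
  have card_S : (sparsity θ₀ : ℝ) = S.card := by
    rw [sparsity, Set.ncard_eq_toFinset_card', Set.toFinset_ofPred]
  have cauchy_schwarz :
      ∑ j ∈ S, |(θ - θ₀) j| ≤ √(sparsity θ₀ : ℝ) * √((θ - θ₀) ⬝ᵥ (θ - θ₀)) := by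
    rw [← Real.sqrt_mul (Nat.cast_nonneg _), card_S]
    refine Real.le_sqrt_of_sq_le (sq_sum_le_card_mul_sum_sq.trans ?_)
    gcongr
    simp only [sq_abs, dotProduct, ← sq]
    exact Finset.sum_le_sum_of_subset_of_nonneg (Finset.subset_univ _) fun _ _ _ => sq_nonneg _
  have triangle : ∑ j, (|θ₀ j| - |θ j| + |(θ - θ₀) j|) ≤ ∑ j ∈ S, 2 * |(θ - θ₀) j| := by
    rw [Finset.sum_filter]
    refine Finset.sum_le_sum fun j _ => ?_
    split_ifs with hj
    · have := abs_sub_abs_le_abs_sub (θ₀ j) (θ j)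
      rw [abs_sub_comm] at this
      simp only [Pi.sub_apply]; linarith
    · simp [not_not.1 hj]
  rw [Finset.sum_add_distrib, Finset.sum_sub_distrib, ← Finset.mul_sum] at triangle
  linarith

/-- `m` and `ℓ` stand for the `ℓ₂` and `ℓ₁` errors of the Lasso, `Q` for its prediction error. -/
lemma l1_error_le_of_l2_error {m ℓ Q lam φ D κ : ℝ} (hℓ : 0 ≤ ℓ) (hlam : 0 < lam) (hφ : 0 < φ)
    (hD : 0 ≤ D) (hQ : 0 ≤ Q) (curvature : φ * m ^ 2 - D * ℓ ^ 2 ≤ Q)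
    (basic : 1 / 2 * Q + lam / 2 * ℓ ≤ κ * m) (hDκ : 8 * D * κ ^ 2 ≤ lam ^ 2 * φ) :
    ℓ ≤ 2 * κ ^ 2 / (lam * φ) := by
  have ℓ_le_m : lam * ℓ ≤ 2 * (κ * m) := by linarith
  have gram_error_le : D * ℓ ^ 2 ≤ φ * m ^ 2 / 2 := by
    refine le_of_mul_le_mul_left ?_ (pow_pos hlam 2)
    calc lam ^ 2 * (D * ℓ ^ 2) = D * (lam * ℓ) ^ 2 := by ring
      _ ≤ D * (2 * (κ * m)) ^ 2 := by gcongr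
      _ = 8 * D * κ ^ 2 * m ^ 2 / 2 := by ring
      _ ≤ lam ^ 2 * φ * m ^ 2 / 2 := by gcongr
      _ = lam ^ 2 * (φ * m ^ 2 / 2) := by ring
  have quadratic_le : φ * m ^ 2 / 4 + lam / 2 * ℓ ≤ κ * m := by linarith
  rw [le_div_iff₀ (by positivity)]
  nlinarith [sq_nonneg (φ * m - 2 * κ), mul_le_mul_of_nonneg_left quadratic_le hφ.le]

lemma lasso_l1_error_le {t φ D : ℝ} (hlam : 0 < lam) (ht : 0 ≤ t) (hφ : 0 < φ) (hD0 : 0 ≤ D)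
    (h : lassoObj n A z lam θhat ≤ lassoObj n A z lam θ₀) (hθ₀ : θ₀ ⬝ᵥ θ₀ ≤ 1)
    (gram_le : ∀ j k, |gramError n φ A j k| ≤ D)
    (noise_le : ∀ j, |((1 / (n : ℝ)) • (Aᵀ *ᵥ (z - A *ᵥ θ₀))) j + t * θ₀ j| ≤ lam / 2)
    (hD : 8 * D * (2 * lam * √(sparsity θ₀ : ℝ) + t) ^ 2 ≤ lam ^ 2 * φ) :
    ∑ j, |(θhat - θ₀) j| ≤ 2 * (2 * lam * √(sparsity θ₀ : ℝ) + t) ^ 2 / (lam * φ) := by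
  have basic := lasso_basic_inequality h
  have noise := dotProduct_le_of_abs_add_smul_le ht hθ₀ noise_le (θhat - θ₀)
  have l1_sub := mul_le_mul_of_nonneg_left (l1_sub_l1_le θ₀ θhat) hlam.le
  have curvature := mul_dotProduct_self_sub_le gram_le (θhat - θ₀)
  rw [← Real.sq_sqrt (dotProduct_self_nonneg (θhat - θ₀))] at curvature
  refine l1_error_le_of_l2_error (Finset.sum_nonneg fun _ _ => abs_nonneg _) hlam hφ hD0
    (mul_nonneg (by positivity) (dotProduct_self_nonneg _)) curvature ?_ hD
  linarith

end Lasso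

lemma dotProduct_col_self_le {m κ : Type*} [Fintype m] [DecidableEq κ] {n : ℕ} (hn : 0 < n)
    {A : Matrix m κ ℝ} {φ a : ℝ} {j : κ} (h : gramError n φ A j j ≤ a) :
    Aᵀ j ⬝ᵥ Aᵀ j ≤ n * (φ + a) := by
  have hn' : (0 : ℝ) < n := by exact_mod_cast hn
  rw [gramError, Matrix.sub_apply, Matrix.smul_apply, Matrix.smul_apply, Matrix.one_apply_eq,
    smul_eq_mul, smul_eq_mul, mul_one, sub_le_iff_le_add', one_div_mul_eq_div,
    div_le_iff₀' hn'] at h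
  exact h

lemma NearlyPreserves.abs_one_div_mul_dotProduct_le {ι κ : Type*} [Fintype ι] [Fintype κ]
    [DecidableEq κ] {R : Matrix ι κ ℝ} {s : ℝ} {u v : κ → ℝ} (h : NearlyPreserves R s u v)
    (hs : 0 ≤ s) {n : ℕ} (hn : 0 < n) {B C : ℝ} (hu : u ⬝ᵥ u ≤ n * B) (hv : v ⬝ᵥ v ≤ n * C) :
    |1 / n * (u ⬝ᵥ ((Rᵀ * R - 1) *ᵥ v))| ≤ s * (√B * √C) := by
  have hn' : (0 : ℝ) < n := by exact_mod_cast hn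
  rw [one_div_mul_eq_div, abs_div, abs_of_pos hn', div_le_iff₀' hn']
  calc |u ⬝ᵥ ((Rᵀ * R - 1) *ᵥ v)| ≤ s * (√(u ⬝ᵥ u) * √(v ⬝ᵥ v)) := h.abs_dotProduct_le
    _ ≤ s * (√(n * B) * √(n * C)) := by gcongr
    _ = √n * √n * (s * (√B * √C)) := by
        rw [Real.sqrt_mul hn'.le, Real.sqrt_mul hn'.le]; ring
    _ = n * (s * (√B * √C)) := by rw [Real.mul_self_sqrt hn'.le]

/-- The event on which the error analysis of the private Lasso is deterministic: the empirical
covariance is within `a` of the identity, the noise is of its typical size and nearly uncorrelated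
with the design, up to the confidence parameter `l`, and `R` preserves up to the relative error `s`
the inner products of the columns of the stacked design with each other and with the noise. -/
structure IsRegular {n p r : ℕ} (R : Matrix (Fin r) (Cols n p) ℝ) (X : Matrix (Fin n) (Fin p) ℝ)
    (ξ : Fin n → ℝ) (w σ : ℝ) (θ₀ : Fin p → ℝ) (l a s : ℝ) : Prop where
  gram : ∀ j k, |gramError n 1 X j k| ≤ a
  cross : ∀ j, |Xᵀ j ⬝ᵥ ξ| ≤ 2 * σ * √l * √(Xᵀ j ⬝ᵥ Xᵀ j)
  noise : ξ ⬝ᵥ ξ ≤ n * σ ^ 2 * l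
  proj : ∀ j k, NearlyPreserves R s ((stackedDesign X w)ᵀ j) ((stackedDesign X w)ᵀ k)
  proj_noise : ∀ j, NearlyPreserves R s ((stackedDesign X w)ᵀ j) (stackedNoise ξ w θ₀)
  proj_shift : ∀ j, NearlyPreserves R s ((stackedDesign X w)ᵀ j) (stackedNoise 0 w θ₀)

namespace IsRegular

variable {n p r : ℕ} {R : Matrix (Fin r) (Cols n p) ℝ} {X : Matrix (Fin n) (Fin p) ℝ}
  {ξ : Fin n → ℝ} {w σ l a s K lam : ℝ} {θ₀ θhat : Fin p → ℝ}

lemma dotProduct_stackedDesign_col_le (h : IsRegular R X ξ w σ θ₀ l a s) (hn : 0 < n) (ha : a ≤ 1)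
    (hK : w ^ 2 / n ≤ K) (j : Fin p) :
    (stackedDesign X w)ᵀ j ⬝ᵥ (stackedDesign X w)ᵀ j ≤ n * (2 + K) := by
  have dot_eq : (stackedDesign X w)ᵀ j ⬝ᵥ (stackedDesign X w)ᵀ j = Xᵀ j ⬝ᵥ Xᵀ j + w ^ 2 := by
    refine (congr_fun₂ (transpose_stackedDesign_mul_self X w) j j).trans ?_
    rw [Matrix.add_apply, Matrix.smul_apply, Matrix.one_apply_eq, smul_eq_mul, mul_one]
    rfl
  have X_col_le := dotProduct_col_self_le hn ((le_abs_self _).trans ((h.gram j j).trans ha))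
  rw [div_le_iff₀' (by exact_mod_cast hn)] at hK
  linarith

lemma abs_gramError_le (h : IsRegular R X ξ w σ θ₀ l a s) (hn : 0 < n) (ha : a ≤ 1) (hs : 0 ≤ s)
    (hK : w ^ 2 / n ≤ K) (j k : Fin p) :
    |gramError n (phi n w) (R * stackedDesign X w) j k| ≤ a + s * (2 + K) := by
  have hK0 : 0 ≤ K := (by positivity : 0 ≤ w ^ 2 / n).trans hK
  have proj_le := (h.proj j k).abs_one_div_mul_dotProduct_le hs hn
    (h.dotProduct_stackedDesign_col_le hn ha hK j) (h.dotProduct_stackedDesign_col_le hn ha hK k)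
  rw [Real.mul_self_sqrt (by linarith)] at proj_le
  rw [gramError_mul_stackedDesign]
  exact (abs_add_le _ _).trans (add_le_add (h.gram j k) proj_le)

lemma abs_score_add_shift_le (h : IsRegular R X ξ w σ θ₀ l a s) (hn : 0 < n) (hθ₀ : θ₀ ⬝ᵥ θ₀ = 1)
    (hσ : 0 < σ) (hl : 0 ≤ l) (ha : a ≤ 1) (hs : 0 ≤ s) (hK : w ^ 2 / n ≤ K) (j : Fin p) :
    |((1 / (n : ℝ)) • ((R * stackedDesign X w)ᵀ *ᵥ (R *ᵥ stackedNoise ξ w θ₀))) j +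
        w ^ 2 / n * θ₀ j| ≤
      s * (√(2 + K) * √(σ ^ 2 * l + 2 * K)) + 3 * σ * √(l / n) := by
  have hn' : (0 : ℝ) < n := by exact_mod_cast hn
  have noise_sq_le : stackedNoise ξ w θ₀ ⬝ᵥ stackedNoise ξ w θ₀ ≤ n * (σ ^ 2 * l + 2 * K) := by
    rw [stackedNoise_dotProduct_self, hθ₀]
    rw [div_le_iff₀' hn'] at hK
    linarith [h.noise]
  have proj_le := (h.proj_noise j).abs_one_div_mul_dotProduct_le hs hn
    (h.dotProduct_stackedDesign_col_le hn ha hK j) noise_sq_le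
  have sqrt_col_le : √(Xᵀ j ⬝ᵥ Xᵀ j) ≤ 3 / 2 * √n := by
    have X_col_le := dotProduct_col_self_le hn ((le_abs_self _).trans ((h.gram j j).trans ha))
    refine Real.sqrt_le_iff.2 ⟨by positivity, ?_⟩
    rw [mul_pow, Real.sq_sqrt hn'.le]
    linarith
  have cross_le : |1 / n * (Xᵀ j ⬝ᵥ ξ)| ≤ 3 * σ * √(l / n) := by
    rw [one_div_mul_eq_div, abs_div, abs_of_pos hn', div_le_iff₀ hn']
    calc |Xᵀ j ⬝ᵥ ξ| ≤ 2 * σ * √l * √(Xᵀ j ⬝ᵥ Xᵀ j) := h.cross j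
      _ ≤ 2 * σ * √l * (3 / 2 * √n) := by gcongr
      _ = 3 * σ * √(l / n) * n := by
          rw [Real.sqrt_div hl]
          nth_rw 3 [← Real.mul_self_sqrt hn'.le]
          field_simp
  have entry_eq := congr_fun (score_add_shift_eq R X ξ w θ₀) j
  rw [Pi.add_apply, Pi.smul_apply (w ^ 2 / (n : ℝ)), smul_eq_mul] at entry_eq
  rw [entry_eq]
  exact (abs_add_le _ _).trans (add_le_add proj_le cross_le)

lemma l1_error_le (h : IsRegular R X ξ w σ θ₀ l a s) (hn : 0 < n) (hθ₀ : θ₀ ⬝ᵥ θ₀ = 1)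
    (hmin : IsPrivateLasso R X (response X θ₀ ξ) w lam θhat)
    (hσ : 0 < σ) (hl : 0 ≤ l) (ha0 : 0 ≤ a) (ha : a ≤ 1) (hs : 0 ≤ s) (hlam : 0 < lam)
    (hK : w ^ 2 / n ≤ K)
    (gram_small : 8 * (a + s * (2 + K)) * kappa n (sparsity θ₀) lam w ^ 2 ≤ lam ^ 2 * phi n w)
    (noise_small : s * (√(2 + K) * √(σ ^ 2 * l + 2 * K)) + 3 * σ * √(l / n) ≤ lam / 2) :
    ∑ j, |(θhat - θ₀) j| ≤ 2 * kappa n (sparsity θ₀) lam w ^ 2 / (lam * phi n w) := by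
  have hK0 : 0 ≤ K := (by positivity : 0 ≤ w ^ 2 / n).trans hK
  refine lasso_l1_error_le (t := w ^ 2 / n) hlam (by positivity) (by rw [phi]; positivity)
    (D := a + s * (2 + K)) (by positivity) (hmin θ₀) hθ₀.le (fun j k => ?_) (fun j => ?_) gram_small
  · rw [privX_eq_mul_stackedDesign]
    exact h.abs_gramError_le hn ha hs hK j k
  · rw [privY_sub_privX_mulVec, privX_eq_mul_stackedDesign]
    exact (h.abs_score_add_shift_le hn hθ₀ hσ hl ha hs hK j).trans noise_small

lemma norm_bias_le_of_l1_error (h : IsRegular R X ξ w σ θ₀ l a s) (hn : 0 < n)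
    (hθ₀ : θ₀ ⬝ᵥ θ₀ = 1) (ha0 : 0 ≤ a) (ha : a ≤ 1) (hs : 0 ≤ s) (hK : w ^ 2 / n ≤ K) {ℓ : ℝ}
    (hℓ : ∑ j, |(θhat - θ₀) j| ≤ ℓ) :
    ‖bias R X w θ₀ θhat‖ ≤
      (a + s * (2 + K)) * ℓ + s * (√(2 + K) * √(2 * (w ^ 2 / n))) := by
  have hK0 : 0 ≤ K := (by positivity : 0 ≤ w ^ 2 / n).trans hK
  have hℓ0 : 0 ≤ ℓ := (Finset.sum_nonneg fun _ _ => abs_nonneg _).trans hℓ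
  rw [pi_norm_le_iff_of_nonneg (by positivity)]
  intro j
  have shift_sq_le :
      stackedNoise (0 : Fin n → ℝ) w θ₀ ⬝ᵥ stackedNoise 0 w θ₀ ≤ n * (2 * (w ^ 2 / n)) := by
    rw [stackedNoise_dotProduct_self, hθ₀, zero_dotProduct]
    field_simp
    linarith
  have shift_le := (h.proj_shift j).abs_one_div_mul_dotProduct_le hs hn
    (h.dotProduct_stackedDesign_col_le hn ha hK j) shift_sq_le
  have gram_le : |(gramError n (phi n w) (R * stackedDesign X w) *ᵥ (θ₀ - θhat)) j| ≤
      (a + s * (2 + K)) * ℓ := by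
    calc _ ≤ ∑ k, |gramError n (phi n w) (R * stackedDesign X w) j k * (θ₀ - θhat) k| :=
          Finset.abs_sum_le_sum_abs _ _
      _ ≤ ∑ k, (a + s * (2 + K)) * |(θhat - θ₀) k| := by
          gcongr with k
          rw [abs_mul, Pi.sub_apply, Pi.sub_apply, abs_sub_comm (θ₀ k)]
          exact mul_le_mul_of_nonneg_right (h.abs_gramError_le hn ha hs hK j k) (abs_nonneg _)
      _ ≤ (a + s * (2 + K)) * ℓ := by
          rw [← Finset.mul_sum]
          gcongr
  rw [Real.norm_eq_abs, bias_eq_gramError_mulVec_add]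
  exact (abs_add_le _ _).trans (add_le_add gram_le shift_le)

end IsRegular

namespace IsSample

variable {Ω : Type*} [MeasurableSpace Ω] {P : Measure Ω} {n p r : ℕ} {𝒟 : Measure ℝ} {σ τ : ℝ}
  {X : Ω → Matrix (Fin n) (Fin p) ℝ} {ξ : Ω → Fin n → ℝ} {R : Ω → Matrix (Fin r) (Cols n p) ℝ}
  (h : IsSample P 𝒟 σ τ X ξ R)
include h

lemma aemeasurable_entries : ∀ e, AEMeasurable (entries X ξ R e) P
  | .inl ij => (h.law_design ij.1 ij.2).aemeasurable
  | .inr (.inl i) => (h.law_noise i).aemeasurable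
  | .inr (.inr ac) => (h.law_proj ac.1 ac.2).aemeasurable

lemma iIndepFun_design : iIndepFun (fun (q : Fin n × Fin p) ω => X ω q.1 q.2) P :=
  h.indep.precomp Sum.inl_injective

lemma iIndepFun_noise : iIndepFun (fun i ω => ξ ω i) P :=
  h.indep.precomp (Sum.inr_injective.comp Sum.inl_injective)

lemma isGaussianProjection : IsGaussianProjection R P where
  law a c := by simpa only [Fintype.card_fin] using h.law_proj a c
  indep := h.indep.precomp (Sum.inr_injective.comp Sum.inr_injective)

lemma aemeasurable_col (j : Fin p) : AEMeasurable (fun ω => (X ω)ᵀ j) P :=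
  aemeasurable_pi_lambda _ fun i => h.aemeasurable_entries (.inl (i, j))

lemma aemeasurable_noise : AEMeasurable ξ P :=
  aemeasurable_pi_lambda _ fun i => h.aemeasurable_entries (.inr (.inl i))

lemma indepFun_col_noise (j : Fin p) : IndepFun (fun ω => (X ω)ᵀ j) ξ P :=
  indepFun_subfamilies h.aemeasurable_entries h.indep (fun i => .inl (i, j)) (.inr ∘ .inl) (by simp)

lemma indepFun_design_noise_proj : IndepFun (fun ω => ((fun i j => X ω i j), ξ ω))
    (fun ω (q : Fin r × Cols n p) => R ω q.1 q.2) P :=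
  (indepFun_subfamilies h.aemeasurable_entries h.indep
    (Sum.elim .inl (.inr ∘ .inl) : (Fin n × Fin p) ⊕ Fin n → _) (.inr ∘ .inr)
    (by rintro (_ | _) _ <;> simp)).comp
    (φ := fun x => ((fun i j => x (.inl (i, j))), fun i => x (.inr i))) (ψ := id)
    (by fun_prop) measurable_id

lemma hasSubgaussianMGF_noise (hσ : 0 < σ) (hτ : 0 < τ) (i : Fin n) :
    HasSubgaussianMGF (fun ω => ξ ω i) (σ ^ 2).toNNReal P := by
  refine HasSubgaussianMGF.of_map (X := id) (h.law_noise i).aemeasurable ?_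
  rw [(h.law_noise i).map_eq]
  exact hasSubgaussianMGF_truncGaussian hσ hτ

lemma measureReal_abs_col_dotProduct_noise_gt_le (hσ : 0 < σ) (hτ : 0 < τ) {l : ℝ} (hl : 0 ≤ l)
    (j : Fin p) :
    P.real {ω | 2 * σ * √l * √((X ω)ᵀ j ⬝ᵥ (X ω)ᵀ j) < |(X ω)ᵀ j ⬝ᵥ ξ ω|} ≤
      2 * Real.exp (-(2 * l)) := by
  have tail_le := measureReal_abs_dotProduct_indep_gt_le (Real.toNNReal_pos.2 (pow_pos hσ 2))
    (h.hasSubgaussianMGF_noise hσ hτ) h.iIndepFun_noise (h.aemeasurable_col j)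
    (h.indepFun_col_noise j) hl
  rwa [Real.coe_toNNReal _ (sq_nonneg σ), Real.sqrt_sq hσ.le] at tail_le

lemma measureReal_noise_dotProduct_self_gt_le (hn : 0 < n) (hσ : 0 < σ) (hτ : 0 < τ) {l : ℝ}
    (hl : 0 < l) : P.real {ω | n * σ ^ 2 * l < ξ ω ⬝ᵥ ξ ω} ≤ 1 / l := by
  have := h.indep.isProbabilityMeasure
  have : Nonempty (Fin n) := ⟨⟨0, hn⟩⟩
  have integrable_sq (i : Fin n) : Integrable (fun ω => ξ ω i ^ 2) P :=
    (((h.law_noise i).map_eq ▸ integrable_sq_truncGaussian hσ hτ).comp_aemeasurable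
      (h.law_noise i).aemeasurable)
  have integral_sq_le (i : Fin n) : ∫ ω, ξ ω i ^ 2 ∂P ≤ σ ^ 2 :=
    ((h.law_noise i).integral_comp (f := fun x => x ^ 2) (by fun_prop)).trans_le
      (integral_sq_truncGaussian_le hσ hτ)
  simpa only [Fintype.card_fin] using
    measureReal_dotProduct_self_gt_le (pow_pos hσ 2) integrable_sq integral_sq_le hl

lemma measureReal_not_nearlyPreserves_le (hr : 0 < r) {l : ℝ} (hl : 0 ≤ l)
    (hs : √(32 * l / r) ≤ 1 / 2) {u v : (Fin n → Fin p → ℝ) × (Fin n → ℝ) → Cols n p → ℝ}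
    (hu : Measurable u) (hv : Measurable v) :
    P.real {ω | ¬ NearlyPreserves (R ω) √(32 * l / r) (u (X ω, ξ ω)) (v (X ω, ξ ω))} ≤
      4 * Real.exp (-(4 * l)) := by
  have aemeasurable_data : AEMeasurable (fun ω => ((fun i j => X ω i j), ξ ω)) P :=
    (aemeasurable_pi_lambda _ fun i => aemeasurable_pi_lambda _ fun j =>
      h.aemeasurable_entries (.inl (i, j))).prodMk h.aemeasurable_noise
  have exponent_eq : (r : ℝ) * √(32 * l / r) ^ 2 / 8 = 4 * l := by
    rw [Real.sq_sqrt (by positivity)]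
    field_simp
    ring
  have := h.isGaussianProjection.measureReal_not_nearlyPreserves_indep_le
    (hu.comp_aemeasurable aemeasurable_data) (hv.comp_aemeasurable aemeasurable_data)
    (h.indepFun_design_noise_proj.comp (hu.prodMk hv) measurable_id) (Real.sqrt_nonneg _) hs
  rwa [Fintype.card_fin, exponent_eq] at this

end IsSample

lemma measurable_stackedDesign_col {n p : ℕ} (w : ℝ) (j : Fin p) :
    Measurable fun x : (Fin n → Fin p → ℝ) × (Fin n → ℝ) => (stackedDesign x.1 w)ᵀ j := by
  refine measurable_pi_lambda _ ?_
  rintro (i | _ | _)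
  · exact (measurable_pi_apply j).comp ((measurable_pi_apply i).comp measurable_fst)
  · exact measurable_const
  · exact measurable_const

lemma measurable_stackedNoise {n p : ℕ} (w : ℝ) (θ₀ : Fin p → ℝ) :
    Measurable fun ξ : Fin n → ℝ => stackedNoise ξ w θ₀ := by
  refine measurable_pi_lambda _ ?_
  rintro (i | _ | _)
  · exact measurable_pi_apply i
  · exact measurable_const
  · exact measurable_const

lemma measureReal_iUnion_le_card_mul {Ω ι : Type*} [MeasurableSpace Ω] [Fintype ι] {P : Measure Ω}
    {E : ι → Set Ω} {c : ℝ} (h : ∀ i, P.real (E i) ≤ c) :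
    P.real (⋃ i, E i) ≤ Fintype.card ι * c := by
  refine (measureReal_iUnion_fintype_le _).trans ((Finset.sum_le_sum fun i _ => h i).trans ?_)
  rw [Finset.sum_const, nsmul_eq_mul, Finset.card_univ]

lemma setOf_not_isRegular_subset {Ω : Type*} {n p r : ℕ} (X : Ω → Matrix (Fin n) (Fin p) ℝ)
    (ξ : Ω → Fin n → ℝ) (R : Ω → Matrix (Fin r) (Cols n p) ℝ) (w σ l a s : ℝ) (θ₀ : Fin p → ℝ) :
    {ω | ¬ IsRegular (R ω) (X ω) (ξ ω) w σ θ₀ l a s} ⊆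
      (⋃ q : Fin p × Fin p, {ω | a < |gramError n 1 (X ω) q.1 q.2|}) ∪
      ((⋃ j, {ω | 2 * σ * √l * √((X ω)ᵀ j ⬝ᵥ (X ω)ᵀ j) < |(X ω)ᵀ j ⬝ᵥ ξ ω|}) ∪
      ({ω | n * σ ^ 2 * l < ξ ω ⬝ᵥ ξ ω} ∪
      ((⋃ q : Fin p × Fin p, {ω | ¬ NearlyPreserves (R ω) s
        ((stackedDesign (X ω) w)ᵀ q.1) ((stackedDesign (X ω) w)ᵀ q.2)}) ∪
      ((⋃ j, {ω | ¬ NearlyPreserves (R ω) s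
        ((stackedDesign (X ω) w)ᵀ j) (stackedNoise (ξ ω) w θ₀)}) ∪
      ⋃ j, {ω | ¬ NearlyPreserves (R ω) s
        ((stackedDesign (X ω) w)ᵀ j) (stackedNoise 0 w θ₀)})))) := by
  intro ω hω
  by_contra h
  simp only [Set.mem_union, Set.mem_iUnion, Set.mem_ofPred_eq, not_or, not_exists, not_not,
    not_lt] at h
  obtain ⟨gram, cross, noise, proj, proj_noise, proj_shift⟩ := h
  exact hω ⟨fun j k => gram (j, k), cross, noise, fun j k => proj (j, k), proj_noise, proj_shift⟩

lemma IsSample.measureReal_not_isRegular_le {Ω : Type*} [MeasurableSpace Ω] {P : Measure Ω}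
    {n p r : ℕ} {𝒟 : Measure ℝ} {b σ τ : ℝ} {X : Ω → Matrix (Fin n) (Fin p) ℝ}
    {ξ : Ω → Fin n → ℝ} {R : Ω → Matrix (Fin r) (Cols n p) ℝ} (h : IsSample P 𝒟 σ τ X ξ R)
    (h𝒟 : IsDesignLaw 𝒟 b) (hn : 0 < n) (hr : 0 < r) (hσ : 0 < σ) (hτ : 0 < τ) (w : ℝ)
    (θ₀ : Fin p → ℝ) {l : ℝ} (hl : 0 < l) (hs : √(32 * l / r) ≤ 1 / 2) :
    P.real {ω | ¬ IsRegular (R ω) (X ω) (ξ ω) w σ θ₀ l (3 * (b ^ 2 + 1) * √(l / n))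
        √(32 * l / r)} ≤
      (6 * p ^ 2 + 8 * p) * Real.exp (-(4 * l)) + 2 * p * Real.exp (-(2 * l)) + 1 / l := by
  have := h.indep.isProbabilityMeasure
  have gram_le := measureReal_iUnion_le_card_mul fun q : Fin p × Fin p =>
    measureReal_abs_gramError_gt_le h𝒟 h.law_design h.iIndepFun_design hn hl.le q.1 q.2
  have cross_le := measureReal_iUnion_le_card_mul
    (h.measureReal_abs_col_dotProduct_noise_gt_le hσ hτ hl.le)
  have noise_le := h.measureReal_noise_dotProduct_self_gt_le hn hσ hτ hl
  have proj_le := measureReal_iUnion_le_card_mul fun q : Fin p × Fin p =>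
    h.measureReal_not_nearlyPreserves_le hr hl.le hs (measurable_stackedDesign_col w q.1)
      (measurable_stackedDesign_col w q.2)
  have proj_noise_le := measureReal_iUnion_le_card_mul fun j : Fin p =>
    h.measureReal_not_nearlyPreserves_le hr hl.le hs (measurable_stackedDesign_col w j)
      ((measurable_stackedNoise w θ₀).comp measurable_snd)
  have proj_shift_le := measureReal_iUnion_le_card_mul fun j : Fin p =>
    h.measureReal_not_nearlyPreserves_le hr hl.le hs (measurable_stackedDesign_col w j)
      (measurable_const (a := stackedNoise 0 w θ₀))
  simp only [Fintype.card_prod, Fintype.card_fin, Nat.cast_mul]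
    at gram_le cross_le proj_le proj_noise_le proj_shift_le
  calc _ ≤ _ := measureReal_mono (setOf_not_isRegular_subset ..)
    _ ≤ _ := (measureReal_union_le _ _).trans <| add_le_add gram_le <|
        (measureReal_union_le _ _).trans <| add_le_add cross_le <|
        (measureReal_union_le _ _).trans <| add_le_add noise_le <|
        (measureReal_union_le _ _).trans <| add_le_add proj_le <|
        (measureReal_union_le _ _).trans <| add_le_add proj_noise_le proj_shift_le
    _ = _ := by ring

section Rates

lemma rho_sq (n r : ℕ) (w : ℝ) :
    rho n r w ^ 2 = ((n : ℝ) + r + 1) / (n * r) + w ^ 2 / (n * r) :=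
  Real.sq_sqrt (by positivity)

lemma rho_pos {n r : ℕ} (hn : 0 < n) (hr : 0 < r) (w : ℝ) : 0 < rho n r w :=
  Real.sqrt_pos.2 (by positivity)

lemma phi_pos (n : ℕ) (w : ℝ) : 0 < phi n w := by
  rw [phi]
  positivity

lemma two_mul_lam_le_kappa {n s₀ : ℕ} {lam : ℝ} (hs : 0 < s₀) (hlam : 0 ≤ lam) (w : ℝ) :
    2 * lam ≤ kappa n s₀ lam w := by
  have one_le_sqrt : 1 ≤ √(s₀ : ℝ) := Real.one_le_sqrt.2 (by exact_mod_cast hs)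
  have : 0 ≤ w ^ 2 / n := by positivity
  rw [kappa]
  linarith [mul_le_mul_of_nonneg_left one_le_sqrt hlam]

lemma lamRate_eq (n p r : ℕ) :
    lamRate n p r = max √(Real.log p / n) (Real.log p * √(Real.log p / r)) := by
  rw [lamRate, show Real.log p ^ 3 / r = Real.log p ^ 2 * (Real.log p / r) by ring,
    Real.sqrt_mul (sq_nonneg _), Real.sqrt_sq (Real.log_natCast_nonneg p)]

lemma lamRate_pos {n p : ℕ} (hn : 0 < n) (hp : 0 < Real.log p) (r : ℕ) : 0 < lamRate n p r :=
  lt_max_of_lt_left (Real.sqrt_pos.2 (by positivity))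

lemma sparsity_pos {p : ℕ} {θ₀ : Fin p → ℝ} (h : θ₀ ⬝ᵥ θ₀ = 1) : 0 < sparsity θ₀ := by
  rw [sparsity, Set.ncard_pos]
  by_contra! support_eq
  have : θ₀ = 0 := funext fun j => not_not.1 fun hj => Set.notMem_empty j (support_eq ▸ hj)
  simp [this] at h

lemma privacyW_pos {B ε δ : ℝ} {r : ℕ} (hB : 0 < B) (hε : 0 < ε) (hδ : 0 < δ)
    (hδ1 : δ < 1 / Real.exp 1) : 0 < privacyW B ε δ r := by
  have inv_e_le : 1 / Real.exp 1 ≤ 1 :=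
    (div_le_one (Real.exp_pos _)).2 (Real.one_le_exp zero_le_one)
  have : 0 < Real.log (4 / δ) := Real.log_pos ((one_lt_div hδ).2 (by linarith))
  exact Real.sqrt_pos.2 (by positivity)

lemma sqrt_mul_sqrt_log_div_eq {n r l w : ℝ} (hn : 0 ≤ n) (hl : 0 ≤ l) (hw : 0 ≤ w) :
    √(w ^ 2 / n) * √(l / r) = w * √l / √(n * r) := by
  rw [Real.sqrt_mul hn, Real.sqrt_div (sq_nonneg w), Real.sqrt_sq hw, Real.sqrt_div hl]
  ring

lemma mul_sqrt_div_le_one {x l m : ℝ} (h : x ≤ √(m / l)) : x * √(l / m) ≤ 1 := by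
  calc x * √(l / m) ≤ √(m / l) * √(l / m) := by gcongr
    _ = √(m / l) * (√(m / l))⁻¹ := by rw [← Real.sqrt_inv, inv_div]
    _ ≤ 1 := mul_inv_le_one

lemma rho_sq_le {n p r : ℕ} {w : ℝ} (hn : 0 < n) (hr : 0 < r) (hl : 1 ≤ Real.log p)
    (ht : 1 ≤ w ^ 2 / n) :
    rho n r w ^ 2 ≤
      2 * (√(w ^ 2 / n) * √(Real.log p / r)) ^ 2 + 2 * √(Real.log p / n) ^ 2 := by
  have hr1 : (1 : ℝ) ≤ r := by exact_mod_cast hr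
  have inv_r_le : 1 / (r : ℝ) ≤ Real.log p / r := by gcongr
  have inv_n_le : 1 / (n : ℝ) ≤ Real.log p / n := by gcongr
  have one_add_inv_r_le : 1 + 1 / (r : ℝ) ≤ 2 := by
    linarith [(div_le_one (one_pos.trans_le hr1)).2 hr1]
  calc rho n r w ^ 2 = (1 + w ^ 2 / n) * (1 / r) + (1 + 1 / r) * (1 / n) := by
        rw [rho_sq]
        field_simp
        ring
    _ ≤ (2 * (w ^ 2 / n)) * (Real.log p / r) + 2 * (Real.log p / n) := by
        gcongr
        linarith
    _ = 2 * (√(w ^ 2 / n) * √(Real.log p / r)) ^ 2 + 2 * √(Real.log p / n) ^ 2 := by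
        rw [mul_pow, Real.sq_sqrt (by positivity), Real.sq_sqrt (by positivity),
          Real.sq_sqrt (by positivity)]
        ring

lemma rho_le_of_shift_le {n p r : ℕ} {w C : ℝ} (hn : 0 < n) (hr : 0 < r) (hl : 1 ≤ Real.log p)
    (ht : 1 ≤ w ^ 2 / n) (hC : 0 ≤ C)
    (h : √(w ^ 2 / n) * √(Real.log p / r) ≤ C * √(Real.log p / n)) :
    rho n r w ≤ 2 * (1 + C) * √(Real.log p / n) := by
  refine le_of_sq_le_sq ?_ (by positivity)
  calc rho n r w ^ 2
      ≤ 2 * (√(w ^ 2 / n) * √(Real.log p / r)) ^ 2 + 2 * √(Real.log p / n) ^ 2 :=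
        rho_sq_le hn hr hl ht
    _ ≤ 2 * (C * √(Real.log p / n)) ^ 2 + 2 * √(Real.log p / n) ^ 2 := by gcongr
    _ = (2 + 2 * C ^ 2) * √(Real.log p / n) ^ 2 := by ring
    _ ≤ (2 * (1 + C)) ^ 2 * √(Real.log p / n) ^ 2 := by gcongr; nlinarith
    _ = _ := by ring

lemma lam_mul_phi_le_kappa_sq {n s₀ : ℕ} {lam w : ℝ} (hs : 0 < s₀) (hlam : 0 ≤ lam)
    (ht : 1 ≤ w ^ 2 / n) : lam * phi n w ≤ kappa n s₀ lam w ^ 2 := by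
  have two_lam_le := two_mul_lam_le_kappa (n := n) hs hlam w
  have noise_level_le : w ^ 2 / n ≤ kappa n s₀ lam w := by
    rw [kappa]
    exact le_add_of_nonneg_left (by positivity)
  have phi_le : phi n w ≤ 2 * kappa n s₀ lam w := by rw [phi]; linarith
  calc lam * phi n w ≤ kappa n s₀ lam w / 2 * (2 * kappa n s₀ lam w) := by
        gcongr
        · exact (phi_pos n w).le
        · linarith
        · linarith
    _ = kappa n s₀ lam w ^ 2 := by ring

lemma noise_level_le {n p r s₀ : ℕ} {w σ lam C : ℝ} (hn : 0 < n) (hr : 0 < r)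
    (hl : 1 ≤ Real.log p) (hs : 0 < s₀) (hσ : 0 < σ) (hlam : 0 < lam) (hC : 0 ≤ C)
    (sparsity_le : √(w ^ 2 / n) * (Real.log p * √(Real.log p / r)) ≤
      C * max √(Real.log p / n) (Real.log p * √(Real.log p / r)))
    (l1_error_lt : 1 / (σ * rho n r w) * (4 * kappa n s₀ lam w ^ 2 / (lam * phi n w)) *
      √(Real.log p / n) < 2 / (σ * (1 + C))) :
    w ^ 2 / n ≤ max 1 (C ^ 2) := by
  by_contra! ht
  obtain ⟨one_lt_t, sq_C_lt_t⟩ := max_lt_iff.1 ht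
  have hα : 0 < √(Real.log p / n) := Real.sqrt_pos.2 (by positivity)
  have hγ : 0 < √(Real.log p / r) := Real.sqrt_pos.2 (by positivity)
  have hρ := rho_pos hn hr w
  have n_dominates : Real.log p * √(Real.log p / r) ≤ √(Real.log p / n) := by
    by_contra! r_dominates
    rw [max_eq_right r_dominates.le] at sparsity_le
    exact (Real.lt_sqrt_of_sq_lt sq_C_lt_t).not_ge
      (le_of_mul_le_mul_right sparsity_le (by positivity))
  rw [max_eq_left n_dominates] at sparsity_le
  have rho_le : rho n r w ≤ 2 * (1 + C) * √(Real.log p / n) :=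
    rho_le_of_shift_le hn hr hl one_lt_t.le hC <| sparsity_le.trans' <| by
      gcongr
      exact le_mul_of_one_le_left hγ.le hl
  have four_le : 4 ≤ 4 * kappa n s₀ lam w ^ 2 / (lam * phi n w) := by
    have := phi_pos n w
    rw [le_div_iff₀ (by positivity)]
    linarith [lam_mul_phi_le_kappa_sq hs hlam.le one_lt_t.le]
  refine l1_error_lt.not_ge ?_
  calc 2 / (σ * (1 + C))
      = 1 / (σ * (2 * (1 + C) * √(Real.log p / n))) * 4 * √(Real.log p / n) := by
        field_simp
        norm_num
    _ ≤ 1 / (σ * rho n r w) * (4 * kappa n s₀ lam w ^ 2 / (lam * phi n w)) *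
          √(Real.log p / n) := by gcongr

lemma sqrt_noise_level_mul_le {s₀ : ℕ} {n r l w C : ℝ} (hn : 0 < n) (hr : 0 < r) (hl : 0 < l)
    (hw : 0 < w) (hs : 0 < s₀)
    (h : √(s₀ : ℝ) ≤
      C * (max (1 / √n) (l / √r) / max (w * l / √(n * r)) (w ^ 2 / n * √(l / r)))) :
    √(w ^ 2 / n) * (l * √(l / r)) ≤ C * max √(l / n) (l * √(l / r)) := by
  have denom_pos : 0 < max (w * l / √(n * r)) (w ^ 2 / n * √(l / r)) :=
    lt_max_of_lt_left (by positivity)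
  have one_le_sqrt : 1 ≤ √(s₀ : ℝ) := Real.one_le_sqrt.2 (by exact_mod_cast hs)
  rw [← mul_div_assoc, le_div_iff₀ denom_pos] at h
  calc √(w ^ 2 / n) * (l * √(l / r)) = w * l / √(n * r) * √l := by
        rw [mul_left_comm, sqrt_mul_sqrt_log_div_eq hn.le hl.le hw.le]
        ring
    _ ≤ C * max (1 / √n) (l / √r) * √l := by
        gcongr
        exact (le_max_left _ _).trans ((le_mul_of_one_le_left denom_pos.le one_le_sqrt).trans h)
    _ = C * max √(l / n) (l * √(l / r)) := by
        rw [mul_assoc, max_mul_of_nonneg _ _ (Real.sqrt_nonneg l), Real.sqrt_div hl.le,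
          Real.sqrt_div hl.le, one_div_mul_eq_div, div_mul_eq_mul_div, mul_div_assoc]

lemma eventually_mul_sqrt_le_mul {σ K : ℝ} (hσ : 0 < σ) (hK : 0 ≤ K) :
    ∀ᶠ l in atTop, 6 * (√(2 + K) * √(σ ^ 2 * l + 2 * K)) ≤ σ * l := by
  filter_upwards [eventually_ge_atTop 1, eventually_ge_atTop (36 * (2 + K) * (1 + 2 * K / σ ^ 2))]
    with l one_le le_l
  refine le_of_sq_le_sq ?_ (by positivity)
  have noise_le : σ ^ 2 * l + 2 * K ≤ σ ^ 2 * l * (1 + 2 * K / σ ^ 2) := by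
    calc σ ^ 2 * l + 2 * K ≤ σ ^ 2 * l + 2 * K * l := by
          grw [le_mul_of_one_le_right (by positivity : 0 ≤ 2 * K) one_le]
      _ = σ ^ 2 * l * (1 + 2 * K / σ ^ 2) := by field_simp
  calc (6 * (√(2 + K) * √(σ ^ 2 * l + 2 * K))) ^ 2
      = 36 * (2 + K) * (σ ^ 2 * l + 2 * K) := by
        rw [mul_pow, mul_pow, Real.sq_sqrt (by positivity), Real.sq_sqrt (by positivity)]
        ring
    _ ≤ 36 * (2 + K) * (σ ^ 2 * l * (1 + 2 * K / σ ^ 2)) := by gcongr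
    _ = 36 * (2 + K) * (1 + 2 * K / σ ^ 2) * (σ ^ 2 * l) := by ring
    _ ≤ l * (σ ^ 2 * l) := by gcongr
    _ = (σ * l) ^ 2 := by ring

lemma scoreBound_le_half_lam {n p r : ℕ} {σ K lam : ℝ} (hσ : 0 < σ)
    (log_large : 6 * (√(2 + K) * √(σ ^ 2 * Real.log p + 2 * K)) ≤ σ * Real.log p)
    (hlam : 8 * σ * lamRate n p r ≤ lam) :
    √(32 * Real.log p / r) * (√(2 + K) * √(σ ^ 2 * Real.log p + 2 * K)) +
      3 * σ * √(Real.log p / n) ≤ lam / 2 := by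
  have sqrt_le : √(32 * Real.log p / r) ≤ 6 * √(Real.log p / r) := by
    rw [mul_div_assoc, Real.sqrt_mul (by norm_num)]
    gcongr
    exact Real.sqrt_le_iff.2 ⟨by norm_num, by norm_num⟩
  have proj_le : √(32 * Real.log p / r) * (√(2 + K) * √(σ ^ 2 * Real.log p + 2 * K)) ≤
      σ * lamRate n p r := by
    calc _ ≤ 6 * √(Real.log p / r) * (√(2 + K) * √(σ ^ 2 * Real.log p + 2 * K)) := by gcongr
      _ = 6 * (√(2 + K) * √(σ ^ 2 * Real.log p + 2 * K)) * √(Real.log p / r) := by ring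
      _ ≤ σ * Real.log p * √(Real.log p / r) := by gcongr
      _ = σ * (Real.log p * √(Real.log p / r)) := mul_assoc ..
      _ ≤ σ * lamRate n p r := by
          rw [lamRate_eq]
          gcongr
          exact le_max_right ..
  have noise_le : 3 * σ * √(Real.log p / n) ≤ 3 * σ * lamRate n p r := by
    gcongr
    exact le_max_left ..
  linarith

variable {ι : Type*} {F : Filter ι}

lemma eventually_lam_pos {σ : ℝ} {n p r : ι → ℕ} {lam : ι → ℝ} (hσ : 0 < σ)
    (hn : ∀ᶠ k in F, 0 < n k) (hp : Tendsto (fun k => Real.log (p k)) F atTop)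
    (hlam : ∀ k, 8 * σ * lamRate (n k) (p k) (r k) ≤ lam k) : ∀ᶠ k in F, 0 < lam k := by
  filter_upwards [hn, hp.eventually_gt_atTop 0] with k hnk hpk
  exact (mul_pos (by positivity) (lamRate_pos hnk hpk (r k))).trans_le (hlam k)

lemma tendsto_mul_zero_of_isLittleO {f g h : ι → ℝ} (hf : f =o[F] g)
    (hgh : ∀ᶠ k in F, |g k * h k| ≤ 1) : Tendsto (fun k => f k * h k) F (𝓝 0) := by
  have isBigO_one : (fun k => g k * h k) =O[F] fun _ => (1 : ℝ) :=
    .of_bound 1 (by simpa using hgh)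
  exact (isLittleO_one_iff ℝ).1 ((hf.mul_isBigO (isBigO_refl h F)).trans_isBigO isBigO_one)

lemma tendsto_mul_sqrt_div_of_isLittleO {f g l m : ι → ℝ} (hf : f =o[F] g)
    (hg0 : ∀ k, 0 ≤ g k) (hg : ∀ᶠ k in F, g k ≤ √(m k / l k)) :
    Tendsto (fun k => f k * √(l k / m k)) F (𝓝 0) := by
  refine tendsto_mul_zero_of_isLittleO hf (hg.mono fun k hk => ?_)
  rw [abs_of_nonneg (mul_nonneg (hg0 k) (Real.sqrt_nonneg _))]
  exact mul_sqrt_div_le_one hk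

lemma tendsto_sqrt_log_div {n p s₀ m : ι → ℕ} {w lam : ι → ℝ} {K : ℝ} (hs : ∀ k, 0 < s₀ k)
    (hlam : ∀ᶠ k in F, 0 < lam k) (hK : ∀ᶠ k in F, w k ^ 2 / n k ≤ K)
    (hm : Tendsto (fun k => kappa (n k) (s₀ k) (lam k) (w k) ^ 2 / (lam k ^ 2 * phi (n k) (w k)) *
      √(Real.log (p k) / m k)) F (𝓝 0)) :
    Tendsto (fun k => √(Real.log (p k) / m k)) F (𝓝 0) := by
  have dominating := hm.const_mul (1 + K)
  rw [mul_zero] at dominating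
  refine squeeze_zero' (.of_forall fun _ => Real.sqrt_nonneg _) ?_ dominating
  filter_upwards [hlam, hK] with k hlamk hKk
  rw [← mul_assoc]
  refine le_mul_of_one_le_left (Real.sqrt_nonneg _) ?_
  have hφ := phi_pos (n k) (w k)
  have phi_le : phi (n k) (w k) ≤ 1 + K := by rw [phi]; linarith
  rw [← mul_div_assoc, one_le_div (by positivity)]
  have lam_le : lam k ≤ kappa (n k) (s₀ k) (lam k) (w k) := by
    linarith [two_mul_lam_le_kappa (n := n k) (hs k) hlamk.le (w k)]
  have : 0 ≤ 1 + K := hφ.le.trans phi_le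
  rw [mul_comm]
  gcongr

lemma tendsto_gramBound_mul {n r l f : ι → ℝ} (hn : Tendsto (fun k => f k * √(l k / n k)) F (𝓝 0))
    (hr : Tendsto (fun k => f k * √(l k / r k)) F (𝓝 0)) (c K : ℝ) :
    Tendsto (fun k => (c * √(l k / n k) + √(32 * l k / r k) * (2 + K)) * f k) F (𝓝 0) := by
  have limit := (hn.const_mul c).add (hr.const_mul (√32 * (2 + K)))
  rw [mul_zero, mul_zero, add_zero] at limit
  refine limit.congr fun k => ?_
  rw [mul_div_assoc 32, Real.sqrt_mul (by norm_num)]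
  ring

/-- The four rate conditions of the theorem, in its order and along an arbitrary filter. They make
small, respectively, the Gram error relative to the curvature of the loss, the privacy noise level
`w² / n` relative to a constant, and the contributions to the bias of the shift and of the
`ℓ₁`-error of the Lasso. -/
structure RateConditions (F : Filter ι) (σ : ℝ) (n p r s₀ : ι → ℕ) (w lam : ι → ℝ) : Prop where
  gram : (fun k => kappa (n k) (s₀ k) (lam k) (w k) ^ 2 / (lam k ^ 2 * phi (n k) (w k))) =o[F]
    (fun k => √(n k / Real.log (p k)) *
      min 1 (min √((r k : ℝ) / n k) (√((r k : ℝ) * n k) / w k ^ 2)))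
  noise_level : (fun k => √(s₀ k : ℝ)) =O[F]
    (fun k => max (1 / √(n k : ℝ)) (Real.log (p k) / √(r k : ℝ)) /
      max (w k * Real.log (p k) / √((n k : ℝ) * r k)) (w k ^ 2 / n k * √(Real.log (p k) / r k)))
  shift : (fun k => 1 / (σ * rho (n k) (r k) (w k)) * √(s₀ k : ℝ)) =o[F]
    (fun k => min (n k / w k ^ 2 * √(r k / Real.log (p k)))
      (√((n k : ℝ) * r k) / (w k * Real.log (p k))))
  l1_error : (fun k => 1 / (σ * rho (n k) (r k) (w k)) *
      (4 * kappa (n k) (s₀ k) (lam k) (w k) ^ 2 / (lam k * phi (n k) (w k)))) =o[F]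
    (fun k => min √(n k / Real.log (p k)) (min √(r k / Real.log (p k))
      (min (n k / w k ^ 2 * √(r k / Real.log (p k)))
        (√((n k : ℝ) * r k) / (w k * Real.log (p k))))))

namespace RateConditions

variable {σ : ℝ} {n p r s₀ : ι → ℕ} {w lam : ι → ℝ} (h : RateConditions F σ n p r s₀ w lam)
include h

lemma tendsto_gram_mul_sqrt_log_div_n :
    Tendsto (fun k => kappa (n k) (s₀ k) (lam k) (w k) ^ 2 / (lam k ^ 2 * phi (n k) (w k)) *
      √(Real.log (p k) / n k)) F (𝓝 0) :=
  tendsto_mul_sqrt_div_of_isLittleO h.gram (fun k => by positivity) <| .of_forall fun k =>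
    mul_le_of_le_one_right (Real.sqrt_nonneg _) (min_le_left _ _)

lemma tendsto_gram_mul_sqrt_log_div_r (hn : ∀ᶠ k in F, 0 < n k) :
    Tendsto (fun k => kappa (n k) (s₀ k) (lam k) (w k) ^ 2 / (lam k ^ 2 * phi (n k) (w k)) *
      √(Real.log (p k) / r k)) F (𝓝 0) := by
  refine tendsto_mul_sqrt_div_of_isLittleO h.gram (fun k => by positivity) (hn.mono fun k hk => ?_)
  have hn' : (0 : ℝ) < n k := by exact_mod_cast hk
  have := Real.log_natCast_nonneg (p k)
  calc _ ≤ √(n k / Real.log (p k)) * √((r k : ℝ) / n k) := by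
        gcongr
        exact (min_le_right _ _).trans (min_le_left _ _)
    _ = √(r k / Real.log (p k)) := by
        rw [← Real.sqrt_mul (by positivity), mul_comm, div_mul_div_cancel₀ hn'.ne']

lemma tendsto_l1_error_mul_sqrt_log_div_n (hw : ∀ k, 0 < w k) :
    Tendsto (fun k => 1 / (σ * rho (n k) (r k) (w k)) *
      (4 * kappa (n k) (s₀ k) (lam k) (w k) ^ 2 / (lam k * phi (n k) (w k))) *
      √(Real.log (p k) / n k)) F (𝓝 0) :=
  tendsto_mul_sqrt_div_of_isLittleO h.l1_error
    (fun k => by have := hw k; have := Real.log_natCast_nonneg (p k); positivity)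
    (.of_forall fun k => min_le_left _ _)

lemma tendsto_l1_error_mul_sqrt_log_div_r (hw : ∀ k, 0 < w k) :
    Tendsto (fun k => 1 / (σ * rho (n k) (r k) (w k)) *
      (4 * kappa (n k) (s₀ k) (lam k) (w k) ^ 2 / (lam k * phi (n k) (w k))) *
      √(Real.log (p k) / r k)) F (𝓝 0) :=
  tendsto_mul_sqrt_div_of_isLittleO h.l1_error
    (fun k => by have := hw k; have := Real.log_natCast_nonneg (p k); positivity)
    (.of_forall fun k => (min_le_right _ _).trans (min_le_left _ _))

lemma tendsto_shift (hp : Tendsto (fun k => Real.log (p k)) F atTop) (hw : ∀ k, 0 < w k)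
    (hs : ∀ k, 0 < s₀ k) :
    Tendsto (fun k => 1 / (σ * rho (n k) (r k) (w k)) *
      (√(w k ^ 2 / n k) * √(Real.log (p k) / r k))) F (𝓝 0) := by
  have tendsto_with_sparsity : Tendsto (fun k => 1 / (σ * rho (n k) (r k) (w k)) * √(s₀ k : ℝ) *
      (√(w k ^ 2 / n k) * √(Real.log (p k) / r k))) F (𝓝 0) := by
    refine tendsto_mul_zero_of_isLittleO h.shift ?_
    filter_upwards [hp.eventually_ge_atTop 1] with k hl
    have hwk := hw k
    have hl0 : 0 < Real.log (p k) := one_pos.trans_le hl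
    rw [abs_of_nonneg (by positivity),
      sqrt_mul_sqrt_log_div_eq (Nat.cast_nonneg _) hl0.le hwk.le]
    calc _ ≤ √((n k : ℝ) * r k) / (w k * Real.log (p k)) *
          (w k * √(Real.log (p k)) / √((n k : ℝ) * r k)) := by gcongr; exact min_le_right _ _
      _ = √((n k : ℝ) * r k) * (√((n k : ℝ) * r k))⁻¹ * (√(Real.log (p k)) / Real.log (p k)) := by
          field_simp
      _ ≤ 1 * 1 := by
          gcongr
          · exact mul_inv_le_one
          · exact (div_le_one hl0).2 (Real.sqrt_le_self_iff.2 (.inr hl))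
      _ = 1 := one_mul 1
  refine squeeze_zero_norm (fun k => ?_)
    (tendsto_zero_iff_norm_tendsto_zero.1 tendsto_with_sparsity)
  rw [mul_right_comm, norm_mul _ √(s₀ k : ℝ), Real.norm_of_nonneg (Real.sqrt_nonneg (s₀ k : ℝ))]
  exact le_mul_of_one_le_right (norm_nonneg _) (Real.one_le_sqrt.2 (by exact_mod_cast hs k))

lemma exists_noise_level_le (hσ : 0 < σ) (hn : ∀ᶠ k in F, 0 < n k) (hr : ∀ᶠ k in F, 0 < r k)
    (hp : Tendsto (fun k => Real.log (p k)) F atTop) (hw : ∀ k, 0 < w k) (hs : ∀ k, 0 < s₀ k)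
    (hlam : ∀ᶠ k in F, 0 < lam k) : ∃ K, 0 ≤ K ∧ ∀ᶠ k in F, w k ^ 2 / n k ≤ K := by
  obtain ⟨C, hC, sparsity_le⟩ := h.noise_level.exists_nonneg
  refine ⟨max 1 (C ^ 2), by positivity, ?_⟩
  filter_upwards [hn, hr, hlam, hp.eventually_ge_atTop 1, sparsity_le.bound,
    (h.tendsto_l1_error_mul_sqrt_log_div_n hw).eventually_lt_const
      (show 0 < 2 / (σ * (1 + C)) by positivity)] with k hnk hrk hlamk hl sparsity_le l1_error_lt
  have hn' : (0 : ℝ) < n k := by exact_mod_cast hnk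
  have hr' : (0 : ℝ) < r k := by exact_mod_cast hrk
  have hwk := hw k
  have hl0 : 0 < Real.log (p k) := one_pos.trans_le hl
  rw [Real.norm_of_nonneg (by positivity), Real.norm_of_nonneg (by positivity)] at sparsity_le
  exact noise_level_le hnk hrk hl (hs k) hσ hlamk hC
    (sqrt_noise_level_mul_le hn' hr' hl0 hwk (hs k) sparsity_le) l1_error_lt

lemma tendsto_sqrt_log_div_n (hσ : 0 < σ) (hn : ∀ᶠ k in F, 0 < n k) (hr : ∀ᶠ k in F, 0 < r k)
    (hp : Tendsto (fun k => Real.log (p k)) F atTop) (hw : ∀ k, 0 < w k) (hs : ∀ k, 0 < s₀ k)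
    (hlam : ∀ᶠ k in F, 0 < lam k) : Tendsto (fun k => √(Real.log (p k) / n k)) F (𝓝 0) :=
  have ⟨_, _, hK⟩ := h.exists_noise_level_le hσ hn hr hp hw hs hlam
  tendsto_sqrt_log_div hs hlam hK h.tendsto_gram_mul_sqrt_log_div_n

lemma tendsto_sqrt_log_div_r (hσ : 0 < σ) (hn : ∀ᶠ k in F, 0 < n k) (hr : ∀ᶠ k in F, 0 < r k)
    (hp : Tendsto (fun k => Real.log (p k)) F atTop) (hw : ∀ k, 0 < w k) (hs : ∀ k, 0 < s₀ k)
    (hlam : ∀ᶠ k in F, 0 < lam k) : Tendsto (fun k => √(Real.log (p k) / r k)) F (𝓝 0) :=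
  have ⟨_, _, hK⟩ := h.exists_noise_level_le hσ hn hr hp hw hs hlam
  tendsto_sqrt_log_div hs hlam hK (h.tendsto_gram_mul_sqrt_log_div_r hn)

lemma eventually_gramBound_mul_le (hn : ∀ᶠ k in F, 0 < n k) (hlam : ∀ᶠ k in F, 0 < lam k)
    (c K : ℝ) :
    ∀ᶠ k in F, 8 * (c * √(Real.log (p k) / n k) + √(32 * Real.log (p k) / r k) * (2 + K)) *
      kappa (n k) (s₀ k) (lam k) (w k) ^ 2 ≤ lam k ^ 2 * phi (n k) (w k) := by
  have gram_tendsto := tendsto_gramBound_mul h.tendsto_gram_mul_sqrt_log_div_n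
    (h.tendsto_gram_mul_sqrt_log_div_r hn) c K
  filter_upwards [hlam, gram_tendsto.eventually_le_const (show (0 : ℝ) < 1 / 8 by norm_num)]
    with k hlamk gram_le
  have := phi_pos (n k) (w k)
  rw [← mul_div_assoc, div_le_iff₀ (by positivity)] at gram_le
  linarith

lemma tendsto_biasBound (hp : Tendsto (fun k => Real.log (p k)) F atTop) (hw : ∀ k, 0 < w k)
    (hs : ∀ k, 0 < s₀ k) (c K : ℝ) :
    Tendsto (fun k =>
      ((c * √(Real.log (p k) / n k) + √(32 * Real.log (p k) / r k) * (2 + K)) *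
          (2 * kappa (n k) (s₀ k) (lam k) (w k) ^ 2 / (lam k * phi (n k) (w k))) +
        √(32 * Real.log (p k) / r k) * (√(2 + K) * √(2 * (w k ^ 2 / n k)))) /
      (σ * rho (n k) (r k) (w k))) F (𝓝 0) := by
  have l1_error_tendsto := tendsto_gramBound_mul (h.tendsto_l1_error_mul_sqrt_log_div_n hw)
    (h.tendsto_l1_error_mul_sqrt_log_div_r hw) c K
  have limit := (l1_error_tendsto.const_mul (1 / 2)).add
    ((h.tendsto_shift hp hw hs).const_mul (√32 * √(2 + K) * √2))
  rw [mul_zero, mul_zero, add_zero] at limit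
  refine limit.congr fun k => ?_
  rw [mul_div_assoc 32, Real.sqrt_mul (show (0 : ℝ) ≤ 32 by norm_num),
    Real.sqrt_mul (show (0 : ℝ) ≤ 2 by norm_num)]
  ring

end RateConditions

lemma RateConditions.eventually_norm_bias_div_le {σ c η : ℝ} {n p r : ι → ℕ}
    {θ₀ : ∀ k, Fin (p k) → ℝ} {w lam : ι → ℝ}
    (h : RateConditions F σ n p r (fun k => sparsity (θ₀ k)) w lam) (hσ : 0 < σ)
    (hn : ∀ᶠ k in F, 0 < n k) (hr : ∀ᶠ k in F, 0 < r k)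
    (hp : Tendsto (fun k => Real.log (p k)) F atTop) (hθ₀ : ∀ k, θ₀ k ⬝ᵥ θ₀ k = 1)
    (hw : ∀ k, 0 < w k) (hlam : ∀ k, 8 * σ * lamRate (n k) (p k) (r k) ≤ lam k) (hc : 0 ≤ c)
    (hη : 0 < η) :
    ∀ᶠ k in F, ∀ (R : Matrix (Fin (r k)) (Cols (n k) (p k)) ℝ)
      (X : Matrix (Fin (n k)) (Fin (p k)) ℝ) (ξ : Fin (n k) → ℝ) (θhat : Fin (p k) → ℝ),
      IsRegular R X ξ (w k) σ (θ₀ k) (Real.log (p k)) (c * √(Real.log (p k) / n k))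
        √(32 * Real.log (p k) / r k) →
      IsPrivateLasso R X (response X (θ₀ k) ξ) (w k) (lam k) θhat →
      ‖bias R X (w k) (θ₀ k) θhat‖ / (σ * rho (n k) (r k) (w k)) ≤ η := by
  have hs k : 0 < sparsity (θ₀ k) := sparsity_pos (hθ₀ k)
  have lam_pos := eventually_lam_pos hσ hn hp hlam
  obtain ⟨K, hK0, hK⟩ := h.exists_noise_level_le hσ hn hr hp hw hs lam_pos
  have gram_tendsto := (h.tendsto_sqrt_log_div_n hσ hn hr hp hw hs lam_pos).const_mul c
  rw [mul_zero] at gram_tendsto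
  filter_upwards [hn, hr, lam_pos, hK, hp.eventually_ge_atTop 0,
    gram_tendsto.eventually_le_const one_pos, h.eventually_gramBound_mul_le hn lam_pos c K,
    hp.eventually (eventually_mul_sqrt_le_mul hσ hK0),
    (h.tendsto_biasBound hp hw hs c K).eventually_le_const hη]
    with k hnk hrk lam_pos hKk hl gram_le gram_small log_large biasBound_le R X ξ θhat regular lasso
  have := rho_pos hnk hrk (w k)
  have l1_error_le := regular.l1_error_le hnk (hθ₀ k) lasso hσ hl (by positivity) gram_le
    (Real.sqrt_nonneg _) lam_pos hKk gram_small (scoreBound_le_half_lam hσ log_large (hlam k))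
  refine biasBound_le.trans' ?_
  gcongr
  exact regular.norm_bias_le_of_l1_error hnk (hθ₀ k) (by positivity) gram_le (Real.sqrt_nonneg _)
    hKk l1_error_le

end Rates

lemma tendsto_failureBound :
    Tendsto (fun x : ℝ => (6 * x ^ 2 + 8 * x) * Real.exp (-(4 * Real.log x)) +
      2 * x * Real.exp (-(2 * Real.log x)) + 1 / Real.log x) atTop (𝓝 0) := by
  have inv_tendsto := tendsto_inv_atTop_zero (𝕜 := ℝ)
  have limit := ((((inv_tendsto.pow 2).const_mul 6).add ((inv_tendsto.pow 3).const_mul 8)).add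
    (inv_tendsto.const_mul 2)).add Real.tendsto_log_atTop.inv_tendsto_atTop
  rw [show (6 * 0 ^ 2 + 8 * 0 ^ 3 + 2 * 0 + 0 : ℝ) = 0 by norm_num] at limit
  refine limit.congr' ?_
  filter_upwards [eventually_gt_atTop 0] with x hx
  have exp_log (m : ℕ) : Real.exp (-(m * Real.log x)) = (x ^ m)⁻¹ := by
    rw [Real.exp_neg, ← Real.log_pow, Real.exp_log (by positivity)]
  have exp_four := exp_log 4
  have exp_two := exp_log 2
  push_cast at exp_four exp_two
  rw [exp_four, exp_two, one_div, Pi.inv_apply]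
  field_simp

lemma tendsto_measure_not_isRegular {ι : Type*} {F : Filter ι} {𝒟 : Measure ℝ} {b σ : ℝ}
    (h𝒟 : IsDesignLaw 𝒟 b) (hσ : 0 < σ) {n p r : ι → ℕ} (hn : ∀ᶠ k in F, 0 < n k)
    (hr : ∀ᶠ k in F, 0 < r k) (hp : Tendsto p F atTop)
    (hpr : Tendsto (fun k => √(Real.log (p k) / r k)) F (𝓝 0))
    {τ : ι → ℝ} (hτ : ∀ k, 0 < τ k) {Ω : ι → Type*} [∀ k, MeasurableSpace (Ω k)]
    {P : ∀ k, Measure (Ω k)} {X : ∀ k, Ω k → Matrix (Fin (n k)) (Fin (p k)) ℝ}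
    {ξ : ∀ k, Ω k → Fin (n k) → ℝ} {R : ∀ k, Ω k → Matrix (Fin (r k)) (Cols (n k) (p k)) ℝ}
    (hS : ∀ k, IsSample (P k) 𝒟 σ (τ k) (X k) (ξ k) (R k)) (w : ι → ℝ)
    (θ₀ : ∀ k, Fin (p k) → ℝ) :
    Tendsto (fun k => P k {ω | ¬ IsRegular (R k ω) (X k ω) (ξ k ω) (w k) σ (θ₀ k)
      (Real.log (p k)) (3 * (b ^ 2 + 1) * √(Real.log (p k) / n k))
      √(32 * Real.log (p k) / r k)}) F (𝓝 0) := by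
  have probability k := (hS k).indep.isProbabilityMeasure
  have hp' := tendsto_natCast_atTop_atTop (R := ℝ) |>.comp hp
  have proj_tendsto := hpr.const_mul √32
  simp only [← Real.sqrt_mul (show (0 : ℝ) ≤ 32 by norm_num), mul_zero, ← mul_div_assoc]
    at proj_tendsto
  refine (ENNReal.tendsto_toReal_zero_iff fun k => measure_ne_top _ _).1 ?_
  refine squeeze_zero' (.of_forall fun _ => ENNReal.toReal_nonneg) ?_
    (tendsto_failureBound.comp hp')
  filter_upwards [hn, hr, (Real.tendsto_log_atTop.comp hp').eventually_gt_atTop 0,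
    proj_tendsto.eventually_le_const one_half_pos] with k hnk hrk hl hs
  exact (hS k).measureReal_not_isRegular_le h𝒟 hnk hrk hσ (hτ k) (w k) (θ₀ k) hl hs

end PrivateLasso

open PrivateLasso in
theorem mainTheorem3_general {ι : Type*} {F : Filter ι} {𝒟 : Measure ℝ} {b σ : ℝ}
    (h𝒟 : IsDesignLaw 𝒟 b) (hσ : 0 < σ) {n p r : ι → ℕ} (hn : ∀ᶠ k in F, 0 < n k)
    (hr : ∀ᶠ k in F, 0 < r k) (hp : Tendsto p F atTop) {τ : ι → ℝ} (hτ : ∀ k, 0 < τ k)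
    {θ₀ : ∀ k, Fin (p k) → ℝ} (hθ₀ : ∀ k, ‖WithLp.toLp 2 (θ₀ k)‖ = 1)
    {Ω : ι → Type*} [∀ k, MeasurableSpace (Ω k)]
    {P : ∀ k, Measure (Ω k)} {X : ∀ k, Ω k → Matrix (Fin (n k)) (Fin (p k)) ℝ}
    {ξ : ∀ k, Ω k → Fin (n k) → ℝ} {R : ∀ k, Ω k → Matrix (Fin (r k)) (Cols (n k) (p k)) ℝ}
    (hS : ∀ k, IsSample (P k) 𝒟 σ (τ k) (X k) (ξ k) (R k)) {w lam : ι → ℝ}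
    (hw : ∀ k, 0 < w k) (hlam : ∀ k, 8 * σ * lamRate (n k) (p k) (r k) ≤ lam k)
    {θhat : ∀ k, Ω k → Fin (p k) → ℝ}
    (hθhat : ∀ k, ∀ᵐ ω ∂P k, IsPrivateLasso (R k ω) (X k ω) (response (X k ω) (θ₀ k) (ξ k ω))
      (w k) (lam k) (θhat k ω))
    (hrate : RateConditions F σ n p r (fun k => sparsity (θ₀ k)) w lam) {η : ℝ} (hη : 0 < η) :
    Tendsto (fun k => P k {ω | η < ‖bias (R k ω) (X k ω) (w k) (θ₀ k) (θhat k ω)‖ /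
      (σ * rho (n k) (r k) (w k))}) F (𝓝 0) := by
  have hlog : Tendsto (fun k => Real.log (p k)) F atTop :=
    Real.tendsto_log_atTop.comp (tendsto_natCast_atTop_atTop.comp hp)
  have hθ₀' k : θ₀ k ⬝ᵥ θ₀ k = 1 := by rw [← norm_toLp_two_sq, hθ₀, one_pow]
  have proj_tendsto := hrate.tendsto_sqrt_log_div_r hσ hn hr hlog hw
    (fun k => sparsity_pos (hθ₀' k)) (eventually_lam_pos hσ hn hlog hlam)
  refine tendsto_of_tendsto_of_tendsto_of_le_of_le' tendsto_const_nhds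
    (tendsto_measure_not_isRegular h𝒟 hσ hn hr hp proj_tendsto hτ hS w θ₀)
    (.of_forall fun _ => zero_le) ?_
  filter_upwards [hrate.eventually_norm_bias_div_le hσ hn hr hlog hθ₀' hw hlam
    (show 0 ≤ 3 * (b ^ 2 + 1) by positivity) hη] with k bias_le
  refine measure_mono_ae ((hθhat k).mono fun ω lasso (bias_gt : η < _) regular => ?_)
  exact bias_gt.not_ge (bias_le _ _ _ _ regular lasso)

open PrivateLasso in
theorem mainTheorem3 :
    ∃ Clam : ℝ, 0 < Clam ∧
    ∀ (𝒟 : Measure ℝ) (b σ : ℝ), IsDesignLaw 𝒟 b → 0 < σ →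
    ∀ (n p r : ℕ → ℕ),
      Tendsto n atTop atTop → Tendsto p atTop atTop → Tendsto r atTop atTop →
    -- truncation levels of the noise
    ∀ (τ : ℕ → ℝ), (∀ k, 0 < τ k) →
      τ =O[atTop] (fun k => σ * √(Real.log (n k))) →
      Tendsto (fun k => τ k / σ - √(2 * Real.log (2 * n k))) atTop atTop →
    ∀ (θ₀ : ∀ k, Fin (p k) → ℝ), (∀ k, ‖WithLp.toLp 2 (θ₀ k)‖ = 1) →
    ∀ (s₀ : ℕ → ℕ), (∀ k, s₀ k = sparsity (θ₀ k)) →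
    -- the random data
    ∀ (Ω : ℕ → Type*) [∀ k, MeasurableSpace (Ω k)] (P : ∀ k, Measure (Ω k))
      [∀ k, IsProbabilityMeasure (P k)]
      (X : ∀ k, Ω k → Matrix (Fin (n k)) (Fin (p k)) ℝ) (ξ : ∀ k, Ω k → Fin (n k) → ℝ)
      (R : ∀ k, Ω k → Matrix (Fin (r k)) (Cols (n k) (p k)) ℝ),
      (∀ k, IsSample (P k) 𝒟 σ (τ k) (X k) (ξ k) (R k)) →
    ∀ (y : ∀ k, Ω k → Fin (n k) → ℝ), (∀ k ω, y k ω = response (X k ω) (θ₀ k) (ξ k ω)) →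
    -- the inputs of the privatization algorithm and the resulting `w`
    ∀ (B ε δ : ℕ → ℝ), (∀ k, 0 < B k) → (∀ k, ∀ᵐ ω ∂P k, RowBound (X k ω) (y k ω) (B k)) →
      (∀ k, 0 < ε k) → (∀ k, 0 < δ k ∧ δ k < 1 / Real.exp 1) →
    ∀ (w : ℕ → ℝ), (∀ k, w k = privacyW (B k) (ε k) (δ k) (r k)) →
    ∀ (lam : ℕ → ℝ), (∀ k, lam k = Clam * σ * lamRate (n k) (p k) (r k)) →
    ∀ (ρ φ κ : ℕ → ℝ), (∀ k, ρ k = rho (n k) (r k) (w k)) → (∀ k, φ k = phi (n k) (w k)) →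
      (∀ k, κ k = kappa (n k) (s₀ k) (lam k) (w k)) →
    -- any version of the private Lasso estimate
    ∀ (θhat : ∀ k, Ω k → Fin (p k) → ℝ),
      (∀ k, ∀ᵐ ω ∂P k,
        IsPrivateLasso (R k ω) (X k ω) (y k ω) (w k) (lam k) (θhat k ω)) →
    -- the four rate conditions
      (fun k => κ k ^ 2 / (lam k ^ 2 * φ k)) =o[atTop]
        (fun k => √(n k / Real.log (p k)) *
          min 1 (min √((r k : ℝ) / n k) (√((r k : ℝ) * n k) / w k ^ 2))) →
      (fun k => √(s₀ k : ℝ)) =O[atTop]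
        (fun k => max (1 / √(n k : ℝ)) (Real.log (p k) / √(r k : ℝ)) /
          max (w k * Real.log (p k) / √((n k : ℝ) * r k))
            (w k ^ 2 / n k * √(Real.log (p k) / r k))) →
      (fun k => 1 / (σ * ρ k) * √(s₀ k : ℝ)) =o[atTop]
        (fun k => min (n k / w k ^ 2 * √(r k / Real.log (p k)))
          (√((n k : ℝ) * r k) / (w k * Real.log (p k)))) →
      (fun k => 1 / (σ * ρ k) * (4 * κ k ^ 2 / (lam k * φ k))) =o[atTop]
        (fun k => min √(n k / Real.log (p k)) (min √(r k / Real.log (p k))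
          (min (n k / w k ^ 2 * √(r k / Real.log (p k)))
            (√((n k : ℝ) * r k) / (w k * Real.log (p k)))))) →
    -- `‖Δ‖∞ = oₚ(σ ρₙ)`; the norm on `Fin (p k) → ℝ` is the max norm
    ∀ η : ℝ, 0 < η →
      Tendsto (fun k => P k {ω | η < ‖bias (R k ω) (X k ω) (w k) (θ₀ k) (θhat k ω)‖ / (σ * ρ k)})
        atTop (𝓝 0) := by
  refine ⟨8, by norm_num, ?_⟩
  intro 𝒟 b σ h𝒟 hσ n p r hn hp hr τ hτ _ _ θ₀ hθ₀ s₀ hs₀ Ω _ P _ X ξ R hS y hy B ε δ hB _ hε hδ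
    w hw lam hlam ρ φ κ hρ hφ hκ θhat hθhat gram noise_level shift l1_error η hη
  obtain ⟨rfl, rfl, rfl, rfl⟩ : s₀ = _ ∧ ρ = _ ∧ φ = _ ∧ κ = _ :=
    ⟨funext hs₀, funext hρ, funext hφ, funext hκ⟩
  exact mainTheorem3_general h𝒟 hσ (hn.eventually_gt_atTop 0) (hr.eventually_gt_atTop 0) hp hτ hθ₀
    hS (fun k => hw k ▸ privacyW_pos (hB k) (hε k) (hδ k).1 (hδ k).2) (fun k => (hlam k).ge)
    (by simpa only [hy] using hθhat) ⟨gram, noise_level, shift, l1_error⟩ hη
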